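/- Let $L\ge 1$, let $n_0,\dots,n_L$ and $d$ be positive integers with $d\le\min\{n_0,\dots,n_L\}$, and let $C_b>0$. Let $W^{(\ell)}\in\mathbb R^{n_\ell\times n_{\ell-1}}$ and $b^{(\ell)}\in\mathbb R^{n_\ell}$, $\ell=1,\dots,L$, be random weights and biases, all of whose entries are independent centered Gaussians, the biases having variance $C_b$. Let $M\subset\mathbb R^{n_0}$ be a smooth embedded $d$-dimensional submanifold (possibly with boundary or corners) of unit volume, $\mathrm{vol}_d(M)=1$, where $\mathrm{vol}_d$ is the $d$-dimensional Hausdorff measure normalized to agree with Lebesgue measure on $\mathbb R^d$. Put $$B=\left(\frac{n_L}{n_0}\right)^{d}\exp\left[-\binom d2\sum_{\ell=1}^{L}\frac1{n_\ell}\right].$$ (a) Let $\mathcal N:\mathbb R^{n_0}\to\mathbb R^{n_L}$ be the fully connected network with ReLU applied in every layer, the output layer included: $x^{(0)}=x$, $x^{(\ell)}=\mathrm{ReLU}(W^{(\ell)}x^{(\ell-1)}+b^{(\ell)})$, $\mathcal N(x)=x^{(L)}$, and let the weights $W^{(\ell)}_{ij}$ have variance $2/n_{\ell-1}$ for all $\ell=1,\dots,L$.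 Then $\mathrm{vol}_d(\mathcal N(M))$ is an almost surely finite, square integrable random variable with $$\mathbb E[\mathrm{vol}_d(\mathcal N(M))]^2\le B\qquad\text{and}\qquad \mathrm{Var}[\mathrm{vol}_d(\mathcal N(M))]\le B.$$ (b) Let instead the output layer be linear, $\mathcal N(x)=W^{(L)}x^{(L-1)}+b^{(L)}$, let the hidden-layer weights $W^{(\ell)}_{ij}$, $\ell<L$, have variance $2/n_{\ell-1}$, and let the output weights $W^{(L)}_{ij}$ have variance $\tau/n_{L-1}$ with $\tau>0$. Then $\mathrm{vol}_d(\mathcal N(M))$ is again almost surely finite and square integrable, and $$\mathbb E[\mathrm{vol}_d(\mathcal N(M))]^2\le \tau^d B\qquad\text{and}\qquad \mathrm{Var}[\mathrm{vol}_d(\mathcal N(M))]\le \tau^d B.$$ In particular the bound is $B$ when the output weights have variance $1/n_{L-1}$. -/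

import Mathlib

open MeasureTheory ProbabilityTheory
open scoped ENNReal NNReal Manifold ContDiff

/-- The coordinatewise ReLU `t ↦ max t 0` on Euclidean space. -/
noncomputable def relu {k : ℕ} (v : EuclideanSpace ℝ (Fin k)) : EuclideanSpace ℝ (Fin k) :=
  WithLp.toLp 2 fun i => max (v i) 0

/-- Weights `W : n_{ℓ+1} × n_ℓ` and biases `b ∈ ℝ^{n_{ℓ+1}}` of the map from layer `ℓ` to
layer `ℓ + 1`, for a network whose layer widths are `n 0, n 1, …`. -/
abbrev LayerParams (n : ℕ → ℕ) (ℓ : ℕ) : Type :=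
  (Fin (n (ℓ + 1)) → Fin (n ℓ) → ℝ) × (Fin (n (ℓ + 1)) → ℝ)

/-- All weights and biases of a network with `L` layers of weights. -/
abbrev NetParams (n : ℕ → ℕ) (L : ℕ) : Type := (ℓ : Fin L) → LayerParams n ℓ

/-- The affine map `h ↦ W h + b`. -/
noncomputable def affineLayer {n : ℕ → ℕ} {ℓ : ℕ} (p : LayerParams n ℓ)
    (h : EuclideanSpace ℝ (Fin (n ℓ))) : EuclideanSpace ℝ (Fin (n (ℓ + 1))) :=
  WithLp.toLp 2 fun i => (∑ j, p.1 i j * h j) + p.2 i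

/-- The vector of activations in layer `k ≤ L`, when ReLU is applied in each of the
layers `1, …, k`. -/
noncomputable def activations {n : ℕ → ℕ} {L : ℕ} (θ : NetParams n L) :
    (k : ℕ) → k ≤ L → EuclideanSpace ℝ (Fin (n 0)) → EuclideanSpace ℝ (Fin (n k))
  | 0, _, x => x
  | k + 1, hk, x =>
      relu (affineLayer (n := n) (ℓ := k) (θ ⟨k, hk⟩) (activations θ k (Nat.le_of_succ_le hk) x))

/-- The vector of preactivations in layer `k ≤ L`: ReLU is applied in layers `1, …, k - 1`
but not in layer `k`. -/
noncomputable def preactivations {n : ℕ → ℕ} {L : ℕ} (θ : NetParams n L) :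
    (k : ℕ) → k ≤ L → EuclideanSpace ℝ (Fin (n 0)) → EuclideanSpace ℝ (Fin (n k))
  | 0, _, x => x
  | k + 1, hk, x =>
      affineLayer (n := n) (ℓ := k) (θ ⟨k, hk⟩) (activations θ k (Nat.le_of_succ_le hk) x)

/-- The network function with ReLU in every layer, the output layer included. -/
noncomputable def reluOutputNetwork {n : ℕ → ℕ} {L : ℕ} (θ : NetParams n L) :
    EuclideanSpace ℝ (Fin (n 0)) → EuclideanSpace ℝ (Fin (n L)) :=
  activations θ L le_rfl

/-- The network function with ReLU in the hidden layers `1, …, L - 1` and a linear (that is,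
affine) output layer. -/
noncomputable def linearOutputNetwork {n : ℕ → ℕ} {L : ℕ} (θ : NetParams n L) :
    EuclideanSpace ℝ (Fin (n 0)) → EuclideanSpace ℝ (Fin (n L)) :=
  preactivations θ L le_rfl

/-- The law of random parameters: all weights and biases are independent centered Gaussians; the
weights from layer `ℓ` to layer `ℓ + 1` have variance `c ℓ / n ℓ` (`n ℓ` is their fan-in), and the
biases have variance `Cb`. -/
noncomputable def paramLaw (n : ℕ → ℕ) (L : ℕ) (c : ℕ → ℝ≥0) (Cb : ℝ≥0) :
    Measure (NetParams n L) :=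
  Measure.pi fun ℓ : Fin L =>
    (Measure.pi fun _ : Fin (n (ℓ + 1)) => Measure.pi fun _ : Fin (n ℓ) =>
      gaussianReal 0 (c ℓ / (n ℓ : ℝ≥0))).prod
    (Measure.pi fun _ : Fin (n (ℓ + 1)) => gaussianReal 0 Cb)

/-- `V` is almost surely finite, is a square integrable random variable, and both the square of its
mean and its variance are at most `B`. -/
def SqMeanAndVarianceLE {Θ : Type*} [MeasurableSpace Θ] (μ : Measure Θ) (V : Θ → ℝ≥0∞)
    (B : ℝ) : Prop :=
  (∀ᵐ θ ∂μ, V θ ≠ ⊤) ∧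
  MemLp (fun θ => (V θ).toReal) 2 μ ∧
  (∫ θ, (V θ).toReal ∂μ) ^ 2 ≤ B ∧
  variance (fun θ => (V θ).toReal) μ ≤ B

/-!
The second moment of the volume of the image controls both its squared mean and its variance, so
everything reduces to `𝔼[vol(𝒩(M))²] ≤ B`, where `B` is the claimed bound.

*Geometry.* For a locally Lipschitz map the area formula gives `vol(𝒩(M)) ≤ ∫_M J`, where `J(x)` is
the Jacobian `√det (AᵀA)` of the derivative `A` of `𝒩` restricted to the tangent space of `M` at `x`.
Both halves of the area formula that are needed are proved from the partition of a set into pieces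
on which a differentiable map is nearly linear: the upper bound for the image of any map
(`euclideanHausdorffMeasure_image_le_lintegral_normDet`) and the lower bound for the image of an
injective one (`lintegral_normDet_le_euclideanHausdorffMeasure_image`). The first applies to
`𝒩 ∘ φ` and the second to `φ`, for countably many local parametrizations `φ` of `M`;
`exists_frameMeasure` packages the result. A tangent frame enters only through its Gram determinant,
so tangent spaces need not be mentioned.

*Probability.* As the biases have no atoms, a fixed input `x` almost surely has only nonzero
preactivations, and then the derivative of the network at `x` is the product of the weight matrices
with rows deleted where a preactivation is negative. Conditionally on the earlier layers, the rows of
the next layer are independent, and by the symmetry `(W, b) ↦ (-W, -b)` the deletion halves their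
second moments; in a linear output layer nothing is deleted, and the variance `τ / n` then produces
the factor `τ ^ d`. For a matrix with `N` independent rows in `ℝᵈ` with second moment matrix `S`,
the expected Gram determinant is `N (N - 1) ⋯ (N - d + 1) det S`
(`integral_det_gram_of_iid_rows`). Hence `𝔼[J(x)²]` does not depend on `x` and equals a product
over the layers, which is at most `B` because `1 - t ≤ exp (-t)` (`prod_descFactorial_le`).

*Conclusion.* By Tonelli and Cauchy–Schwarz in the parameters, `𝔼[(∫_M J)²]` is at most
`(∫_M (𝔼 J²)^(1/2))² ≤ B vol(M)²` (`lintegral_sq_lintegral_le`). The volume of the image depends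
measurably on the parameters because `M` is σ-compact and the Hausdorff premeasures of a compact
image are upper semicontinuous (`measurable_euclideanHausdorffMeasure_image`).
-/

/-! ### The area formula for maps into a Euclidean space -/

open Set in
/-- If `f` is Lipschitz as a function of `g` on `s`, the image of `s` under `f` is at most as large
as the one under `g`, up to the power of the Lipschitz constant. -/
theorem euclideanHausdorffMeasure_image_le_of_dist_le {α X Y : Type*} [MetricSpace X]
    [MeasurableSpace X] [BorelSpace X] [MetricSpace Y] [MeasurableSpace Y] [BorelSpace Y]
    {f : α → X} {g : α → Y} {s : Set α} {K : ℝ≥0} (d : ℕ)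
    (h : ∀ x ∈ s, ∀ y ∈ s, dist (f x) (f y) ≤ K * dist (g x) (g y)) :
    μHE[d] (f '' s) ≤ (K : ℝ≥0∞) ^ d * μHE[d] (g '' s) := by
  rcases s.eq_empty_or_nonempty with rfl | ⟨x₀, hx₀⟩
  · simp
  have : Nonempty α := ⟨x₀⟩
  have hinv : ∀ p ∈ g '' s, Function.invFunOn g s p ∈ s ∧ g (Function.invFunOn g s p) = p :=
    fun p hp => Function.invFunOn_pos hp
  have hlip : LipschitzOnWith K (f ∘ Function.invFunOn g s) (g '' s) := by
    refine LipschitzOnWith.of_dist_le_mul fun p hp q hq => ?_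
    have := h _ (hinv p hp).1 _ (hinv q hq).1
    rwa [(hinv p hp).2, (hinv q hq).2] at this
  have hsub : f '' s ⊆ (f ∘ Function.invFunOn g s) '' (g '' s) := by
    rintro _ ⟨x, hx, rfl⟩
    refine ⟨g x, mem_image_of_mem g hx, ?_⟩
    have h1 := hinv (g x) (mem_image_of_mem g hx)
    have := h _ h1.1 x hx
    rw [h1.2, dist_self, mul_zero] at this
    exact dist_le_zero.1 this
  refine (measure_mono hsub).trans ?_
  simp_rw [Measure.euclideanHausdorffMeasure_def, Measure.smul_apply]
  have := hlip.hausdorffMeasure_image_le (d := (d : ℝ)) (by positivity)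
  calc _ ≤ _ • ((K : ℝ≥0∞) ^ (d : ℝ) * μH[d] (g '' s)) := by gcongr
    _ = _ := by rw [ENNReal.rpow_natCast, ENNReal.smul_def, ENNReal.smul_def, smul_eq_mul,
                  smul_eq_mul, mul_left_comm]

section Area

variable {d : ℕ} {F : Type*} [NormedAddCommGroup F] [InnerProductSpace ℝ F]
  [MeasurableSpace F] [BorelSpace F]

open Set Filter Topology

/-- The map `v ↦ (A v, ε v)`, an injective perturbation of `A` for `ε ≠ 0`. It takes the place of `A`
in upper bounds for Hausdorff measures, so that linear maps of deficient rank need no separate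
treatment. -/
noncomputable def LinearMap.perturb (A : EuclideanSpace ℝ (Fin d) →ₗ[ℝ] F) (ε : ℝ) :
    EuclideanSpace ℝ (Fin d) →ₗ[ℝ] WithLp 2 (F × EuclideanSpace ℝ (Fin d)) :=
  (WithLp.linearEquiv 2 ℝ (F × EuclideanSpace ℝ (Fin d))).symm.toLinearMap ∘ₗ
    A.prod (ε • LinearMap.id)

omit [MeasurableSpace F] [BorelSpace F] in
theorem LinearMap.inner_perturb (A : EuclideanSpace ℝ (Fin d) →ₗ[ℝ] F) (ε : ℝ)
    (v w : EuclideanSpace ℝ (Fin d)) :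
    inner ℝ (A.perturb ε v) (A.perturb ε w) = inner ℝ (A v) (A w) + ε ^ 2 * inner ℝ v w := by
  simp [LinearMap.perturb, WithLp.prod_inner_apply, inner_smul_left, inner_smul_right]
  ring

omit [MeasurableSpace F] [BorelSpace F] in
theorem LinearMap.tendsto_normDet_perturb (A : EuclideanSpace ℝ (Fin d) →ₗ[ℝ] F) :
    Tendsto (fun ε => (A.perturb ε).normDet) (𝓝 0) (𝓝 A.normDet) := by
  let b := EuclideanSpace.basisFun (Fin d) ℝ
  have h1 : ∀ ε, (A.perturb ε).normDet
      = √((Matrix.gram ℝ fun i => A (b i)) + ε ^ 2 • Matrix.gram ℝ b).det := by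
    intro ε
    rw [← Real.sqrt_sq (LinearMap.normDet_nonneg (A.perturb ε))]
    congr 1
    have := LinearMap.normDet_sq_eq_det_gram (A.perturb ε) b
    refine Eq.trans this ?_
    congr 1
    ext i j
    simp only [Matrix.gram_apply, Matrix.add_apply, Matrix.smul_apply, smul_eq_mul]
    exact A.inner_perturb ε _ _
  have h2 : A.normDet = √(Matrix.gram ℝ fun i => A (b i)).det := by
    rw [← Real.sqrt_sq (LinearMap.normDet_nonneg A)]
    congr 1
    exact LinearMap.normDet_sq_eq_det_gram A b
  simp_rw [h1]
  rw [h2]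
  have hc : Continuous fun ε : ℝ =>
      √((Matrix.gram ℝ fun i => A (b i)) + ε ^ 2 • Matrix.gram ℝ b).det := by
    fun_prop
  convert hc.tendsto 0 using 2
  simp

/-- A map close enough to a linear map `A` multiplies volumes by at most about the Jacobian of
`A`. -/
theorem exists_approximatesLinearOn_euclideanHausdorffMeasure_image_le [FiniteDimensional ℝ F]
    (A : EuclideanSpace ℝ (Fin d) →L[ℝ] F) {η : ℝ≥0} (hη : 0 < η) :
    ∃ δ : ℝ≥0, 0 < δ ∧ ∀ (s : Set (EuclideanSpace ℝ (Fin d))) (f : EuclideanSpace ℝ (Fin d) → F),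
      ApproximatesLinearOn f A s δ →
      μHE[d] (f '' s) ≤ (ENNReal.ofReal A.normDet + η) * volume s := by
  -- the factor `(1 + ε) ^ d * J (A, ε)` tends to `J A`
  have hlim : Tendsto (fun ε : ℝ => (1 + ε) ^ d * (A.toLinearMap.perturb ε).normDet) (𝓝[>] 0)
      (𝓝 A.normDet) := by
    have h : Tendsto (fun ε : ℝ => (1 + ε) ^ d) (𝓝 0) (𝓝 1) := by
      have : Continuous fun ε : ℝ => (1 + ε) ^ d := by fun_prop
      simpa using this.tendsto 0
    simpa using (h.mul A.toLinearMap.tendsto_normDet_perturb).mono_left nhdsWithin_le_nhds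
  have hη' : (A.normDet : ℝ) < A.normDet + η := by simpa using hη
  obtain ⟨ε, hε, hε0⟩ := ((hlim.eventually_lt_const hη').and self_mem_nhdsWithin).exists
  replace hε0 : 0 < ε := hε0
  lift ε to ℝ≥0 using hε0.le
  refine ⟨ε ^ 2, pow_pos (by exact_mod_cast hε0) 2, fun s f hf => ?_⟩
  have hdist : ∀ x ∈ s, ∀ y ∈ s, dist (f x) (f y) ≤
      ((1 + ε : ℝ≥0) : ℝ) * dist (A.toLinearMap.perturb ε x) (A.toLinearMap.perturb ε y) := by
    intro x hx y hy
    have h1 := hf x hx y hy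
    rw [dist_eq_norm, dist_eq_norm, ← map_sub]
    have hn : ‖A.toLinearMap.perturb ε (x - y)‖ ^ 2
        = ‖A (x - y)‖ ^ 2 + (ε * ‖x - y‖) ^ 2 := by
      rw [← real_inner_self_eq_norm_sq, LinearMap.inner_perturb]
      simp [mul_pow]
    have hA : ‖A (x - y)‖ ≤ ‖A.toLinearMap.perturb ε (x - y)‖ := by
      refine abs_le_of_sq_le_sq' ?_ (norm_nonneg _) |>.2
      rw [hn]; nlinarith [sq_nonneg (ε * ‖x - y‖)]
    have hε : ε * ‖x - y‖ ≤ ‖A.toLinearMap.perturb ε (x - y)‖ := by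
      refine abs_le_of_sq_le_sq' ?_ (norm_nonneg _) |>.2
      rw [hn]; nlinarith [sq_nonneg (‖A (x - y)‖)]
    calc ‖f x - f y‖ = ‖A (x - y) + (f x - f y - A (x - y))‖ := by congr 1; abel
      _ ≤ ‖A (x - y)‖ + ((ε ^ 2 : ℝ≥0) : ℝ) * ‖x - y‖ := (norm_add_le _ _).trans (by gcongr)
      _ ≤ ‖A.toLinearMap.perturb ε (x - y)‖ + ε * ‖A.toLinearMap.perturb ε (x - y)‖ := by
        push_cast
        rw [pow_two, mul_assoc]
        gcongr
      _ = _ := by push_cast; ring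
  refine (euclideanHausdorffMeasure_image_le_of_dist_le d hdist).trans ?_
  have himg := (A.toLinearMap.perturb ε).euclideanHausdorffMeasure_image_eq_normDet_mul_volume s
  rw [finrank_euclideanSpace_fin] at himg
  rw [himg, ← mul_assoc]
  gcongr
  rw [← ENNReal.ofReal_coe_nnreal, ← ENNReal.ofReal_coe_nnreal,
    ← ENNReal.ofReal_add (LinearMap.normDet_nonneg _) (by positivity),
    ← ENNReal.ofReal_pow (by positivity), ← ENNReal.ofReal_mul (by positivity)]
  refine ENNReal.ofReal_le_ofReal ?_
  push_cast
  exact hε.le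

/-- A map close enough to a linear map `A` multiplies volumes by at least about the Jacobian of
`A`. -/
theorem exists_approximatesLinearOn_le_euclideanHausdorffMeasure_image
    (A : EuclideanSpace ℝ (Fin d) →L[ℝ] F) {η : ℝ≥0} (hη : 0 < η) :
    ∃ δ : ℝ≥0, 0 < δ ∧ ∀ (s : Set (EuclideanSpace ℝ (Fin d))) (f : EuclideanSpace ℝ (Fin d) → F),
      ApproximatesLinearOn f A s δ →
      ENNReal.ofReal A.normDet * volume s ≤ μHE[d] (f '' s) + η * volume s := by
  rcases eq_or_ne A.normDet 0 with h0 | h0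
  · exact ⟨1, one_pos, fun s f _ => by simp [h0]⟩
  have hker : LinearMap.ker A.toLinearMap = ⊥ := by
    by_contra h
    exact h0 (LinearMap.normDet_eq_zero_iff_ker_ne_bot.2 h)
  obtain ⟨K, hK, hA⟩ := A.toLinearMap.exists_antilipschitzWith hker
  -- there is `t < 1` with `t ^ d * J A ≥ J A - η`
  have hlim : Tendsto (fun t : ℝ => t ^ d * A.normDet) (𝓝[<] 1) (𝓝 A.normDet) := by
    have : Continuous fun t : ℝ => t ^ d * A.normDet := by fun_prop
    simpa using (this.tendsto 1).mono_left nhdsWithin_le_nhds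
  have hη' : (A.normDet : ℝ) - η < A.normDet := by simpa using hη
  obtain ⟨t, ⟨ht, ht1⟩, ht0⟩ := (((hlim.eventually_const_lt hη').and self_mem_nhdsWithin).and
    (nhdsWithin_le_nhds (Ioi_mem_nhds (zero_lt_one' ℝ)))).exists
  replace ht1 : t < 1 := ht1
  replace ht0 : 0 < t := ht0
  lift t to ℝ≥0 using ht0.le
  have hKpos : (0 : ℝ) < K := by exact_mod_cast hK
  refine ⟨(1 - t) / K, div_pos (tsub_pos_of_lt (by exact_mod_cast ht1)) hK, fun s f hf => ?_⟩
  have hdist : ∀ x ∈ s, ∀ y ∈ s, dist (A x) (A y) ≤ ((t⁻¹ : ℝ≥0) : ℝ) * dist (f x) (f y) := by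
    intro x hx y hy
    have h1 := hf x hx y hy
    have h2 := hA.le_mul_dist x y
    simp only [ContinuousLinearMap.coe_coe] at h2
    rw [NNReal.coe_div, NNReal.coe_sub (by exact_mod_cast ht1.le), ← dist_eq_norm x y] at h1
    have h3 : dist (A x) (A y) ≤ dist (f x) (f y) + (1 - t) / K * dist x y := by
      rw [dist_eq_norm, dist_eq_norm, ← map_sub]
      calc ‖A (x - y)‖ = ‖(f x - f y) - (f x - f y - A (x - y))‖ := by congr 1; abel
        _ ≤ _ := (norm_sub_le _ _).trans (by gcongr; exact_mod_cast h1)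
    have h4 : (1 - t) / K * dist x y ≤ (1 - t) * dist (A x) (A y) := by
      rw [div_mul_eq_mul_div, div_le_iff₀ hKpos, mul_assoc]
      have : (0 : ℝ) ≤ 1 - t := by linarith
      gcongr
      linarith
    rw [NNReal.coe_inv, inv_mul_eq_div, le_div_iff₀ ht0]
    linarith
  have h := euclideanHausdorffMeasure_image_le_of_dist_le d hdist
  have himg := A.toLinearMap.euclideanHausdorffMeasure_image_eq_normDet_mul_volume s
  rw [finrank_euclideanSpace_fin] at himg
  have himg' : μHE[d] (A '' s) = ENNReal.ofReal A.normDet * volume s := himg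
  rw [himg'] at h
  have h5 : (t : ℝ≥0∞) ^ d * (ENNReal.ofReal A.normDet * volume s) ≤ μHE[d] (f '' s) := by
    calc _ ≤ (t : ℝ≥0∞) ^ d * (((t⁻¹ : ℝ≥0) : ℝ≥0∞) ^ d * μHE[d] (f '' s)) := by gcongr
      _ = μHE[d] (f '' s) := by
        rw [← mul_assoc, ← mul_pow, ← ENNReal.coe_mul, mul_inv_cancel₀ (by exact_mod_cast ht0.ne')]
        simp
  have h6 : ENNReal.ofReal A.normDet ≤ (t : ℝ≥0∞) ^ d * ENNReal.ofReal A.normDet + η := by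
    rw [← ENNReal.ofReal_coe_nnreal, ← ENNReal.ofReal_coe_nnreal,
      ← ENNReal.ofReal_pow (by positivity), ← ENNReal.ofReal_mul (by positivity),
      ← ENNReal.ofReal_add (mul_nonneg (by positivity) (LinearMap.normDet_nonneg _))
        (by positivity)]
    exact ENNReal.ofReal_le_ofReal (by linarith)
  calc _ ≤ ((t : ℝ≥0∞) ^ d * ENNReal.ofReal A.normDet + η) * volume s := by gcongr
    _ = (t : ℝ≥0∞) ^ d * (ENNReal.ofReal A.normDet * volume s) + η * volume s := by ring
    _ ≤ _ := by gcongr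


omit [MeasurableSpace F] [BorelSpace F] in
/-- A measurable set on which `f` is differentiable splits into countably many measurable pieces
on each of which `f` is close to a linear map `A`, as prescribed by `r`, and its Jacobian is within
`η` of the one of `A`. -/
theorem exists_partition_approximatesLinearOn_normDet {s : Set (EuclideanSpace ℝ (Fin d))}
    [SecondCountableTopology F]
    (hs : MeasurableSet s) {f : EuclideanSpace ℝ (Fin d) → F}
    {f' : EuclideanSpace ℝ (Fin d) → EuclideanSpace ℝ (Fin d) →L[ℝ] F}
    (hf' : ∀ x ∈ s, HasFDerivWithinAt f (f' x) s x) (hJ : Measurable fun x => (f' x).normDet)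
    (r : (EuclideanSpace ℝ (Fin d) →L[ℝ] F) → ℝ≥0) (hr : ∀ A, 0 < r A) {η : ℝ≥0} (hη : 0 < η) :
    ∃ (t : ℕ × ℕ → Set (EuclideanSpace ℝ (Fin d)))
      (A : ℕ × ℕ → EuclideanSpace ℝ (Fin d) →L[ℝ] F),
      Pairwise (Function.onFun Disjoint t) ∧ (∀ n, MeasurableSet (t n)) ∧ (⋃ n, t n) = s ∧
      (∀ n, ApproximatesLinearOn f (A n) (t n) (r (A n))) ∧
      ∀ n, ∀ x ∈ t n, |(A n).normDet - (f' x).normDet| ≤ η := by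
  -- slice `s` along the values of the Jacobian
  let S : ℕ → Set (EuclideanSpace ℝ (Fin d)) := fun m =>
    s ∩ {x | ⌊(f' x).normDet / η⌋₊ = m}
  have hSm : ∀ m, MeasurableSet (S m) := fun m =>
    hs.inter ((Nat.measurable_floor.comp (hJ.div_const _)) (measurableSet_singleton m))
  have hSs : ∀ m, S m ⊆ s := fun m => inter_subset_left
  have hSclose : ∀ m, ∀ x ∈ S m, ∀ y ∈ S m, |(f' y).normDet - (f' x).normDet| ≤ η := by
    intro m x hx y hy
    have hη' : (0 : ℝ) < η := hη
    have key : ∀ z ∈ S m, m * η ≤ (f' z).normDet ∧ (f' z).normDet < (m + 1) * η := by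
      intro z hz
      have h := hz.2
      simp only [mem_ofPred_eq] at h
      rw [Nat.floor_eq_iff (div_nonneg (LinearMap.normDet_nonneg _) hη'.le)] at h
      exact ⟨(le_div_iff₀ hη').1 h.1, (div_lt_iff₀ hη').1 h.2⟩
    have h1 := key x hx
    have h2 := key y hy
    rw [abs_le]
    constructor <;> nlinarith
  have hpart := fun m => exists_partition_approximatesLinearOn_of_hasFDerivWithinAt f (S m) f'
    (fun x hx => (hf' x (hSs m hx)).mono (hSs m)) r (fun A => (hr A).ne')
  choose t A htd htm htc hta hA using hpart
  refine ⟨fun p => S p.1 ∩ t p.1 p.2, fun p => A p.1 p.2, ?_, fun p => (hSm _).inter (htm _ _),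
    ?_, fun p => hta _ _, ?_⟩
  · rintro ⟨m, n⟩ ⟨m', n'⟩ hne
    rcases eq_or_ne m m' with rfl | hm
    · have hn : n ≠ n' := fun h => hne (by rw [h])
      exact (htd m hn).mono inter_subset_right inter_subset_right
    · refine Set.disjoint_left.2 fun x hx hx' => hm ?_
      exact hx.1.2.symm.trans hx'.1.2
  · refine Subset.antisymm (iUnion_subset fun p => inter_subset_left.trans (hSs _)) fun x hx => ?_
    have hxS : x ∈ S ⌊(f' x).normDet / η⌋₊ := ⟨hx, rfl⟩
    obtain ⟨n, hn⟩ := mem_iUnion.1 (htc _ hxS)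
    exact mem_iUnion.2 ⟨(_, n), hxS, hn⟩
  · rintro ⟨m, n⟩ x hx
    obtain ⟨y, hy, hAy⟩ := hA m ⟨x, hx.1⟩ n
    simp only [hAy]
    exact hSclose m x hx.1 y hy

theorem le_of_forall_pos_le_add_two_mul_mul {a b c : ℝ≥0∞} (hc : c ≠ ⊤)
    (h : ∀ η : ℝ≥0, 0 < η → a ≤ b + 2 * η * c) : a ≤ b := by
  have hlim : Tendsto (fun η : ℝ≥0 => b + 2 * (η : ℝ≥0∞) * c) (𝓝[>] 0)
      (𝓝 (b + 2 * (0 : ℝ≥0) * c)) := by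
    refine Tendsto.mono_left ?_ nhdsWithin_le_nhds
    refine tendsto_const_nhds.add (ENNReal.Tendsto.mul_const ?_ (Or.inr hc))
    exact ENNReal.Tendsto.const_mul (ENNReal.tendsto_coe.2 tendsto_id) (Or.inr (by simp))
  simp only [ENNReal.coe_zero, mul_zero, zero_mul, add_zero] at hlim
  exact ge_of_tendsto hlim (by filter_upwards [self_mem_nhdsWithin] with η hη using h η hη)

/-- One half of the area formula: the image of `s` has at most the volume `∫_s J`. -/
theorem euclideanHausdorffMeasure_image_le_lintegral_normDet [FiniteDimensional ℝ F]
    {s : Set (EuclideanSpace ℝ (Fin d))}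
    (hs : MeasurableSet s) {f : EuclideanSpace ℝ (Fin d) → F}
    {f' : EuclideanSpace ℝ (Fin d) → EuclideanSpace ℝ (Fin d) →L[ℝ] F}
    (hf' : ∀ x ∈ s, HasFDerivWithinAt f (f' x) s x) (hJ : Measurable fun x => (f' x).normDet) :
    μHE[d] (f '' s) ≤ ∫⁻ x in s, ENNReal.ofReal (f' x).normDet := by
  wlog hfin : volume s ≠ ⊤ generalizing s
  · -- exhaust `s` by sets of finite measure
    have hmono : Monotone fun k => s ∩ spanningSets volume k := fun i j hij =>
      inter_subset_inter_right _ (monotone_spanningSets volume hij)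
    have hU : s = ⋃ k, s ∩ spanningSets volume k := by
      rw [← inter_iUnion, iUnion_spanningSets, inter_univ]
    rw [hU, image_iUnion, Monotone.measure_iUnion fun i j hij => image_mono (hmono hij), ← hU]
    refine iSup_le fun k => ?_
    refine (this (hs.inter (measurableSet_spanningSets volume k))
      (fun x hx => (hf' x hx.1).mono inter_subset_left) ?_).trans
      (lintegral_mono_set inter_subset_left)
    exact ((measure_mono inter_subset_right).trans_lt (measure_spanningSets_lt_top volume k)).ne
  refine le_of_forall_pos_le_add_two_mul_mul hfin fun η hη => ?_
  choose r hr hrA using fun A : EuclideanSpace ℝ (Fin d) →L[ℝ] F =>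
    exists_approximatesLinearOn_euclideanHausdorffMeasure_image_le A hη
  obtain ⟨t, A, htd, htm, rfl, hta, htA⟩ :=
    exists_partition_approximatesLinearOn_normDet hs hf' hJ r hr hη
  calc μHE[d] (f '' ⋃ n, t n) ≤ ∑' n, μHE[d] (f '' t n) := by
        rw [image_iUnion]; exact measure_iUnion_le _
    _ ≤ ∑' n, ∫⁻ x in t n, (ENNReal.ofReal (f' x).normDet + 2 * η) := by
        refine ENNReal.tsum_le_tsum fun n => (hrA _ _ _ (hta n)).trans ?_
        rw [← setLIntegral_const]
        refine setLIntegral_mono (by fun_prop) fun x hx => ?_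
        have := abs_le.1 (htA n x hx)
        rw [two_mul, ← add_assoc]
        gcongr
        rw [← ENNReal.ofReal_coe_nnreal,
          ← ENNReal.ofReal_add (LinearMap.normDet_nonneg (f' x).toLinearMap) η.coe_nonneg]
        exact ENNReal.ofReal_le_ofReal (by linarith)
    _ = ∫⁻ x in ⋃ n, t n, (ENNReal.ofReal (f' x).normDet + 2 * η) :=
        (lintegral_iUnion htm htd _).symm
    _ = _ := by rw [lintegral_add_right _ measurable_const, setLIntegral_const]

/-- The other half of the area formula, for injective maps. -/
theorem lintegral_normDet_le_euclideanHausdorffMeasure_image [CompleteSpace F]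
    [SecondCountableTopology F] {s : Set (EuclideanSpace ℝ (Fin d))}
    (hs : MeasurableSet s) {f : EuclideanSpace ℝ (Fin d) → F}
    {f' : EuclideanSpace ℝ (Fin d) → EuclideanSpace ℝ (Fin d) →L[ℝ] F}
    (hf' : ∀ x ∈ s, HasFDerivWithinAt f (f' x) s x) (hJ : Measurable fun x => (f' x).normDet)
    (hinj : InjOn f s) :
    ∫⁻ x in s, ENNReal.ofReal (f' x).normDet ≤ μHE[d] (f '' s) := by
  wlog hfin : volume s ≠ ⊤ generalizing s
  · have hmono : Monotone fun k => s ∩ spanningSets volume k := fun i j hij =>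
      inter_subset_inter_right _ (monotone_spanningSets volume hij)
    have hU : s = ⋃ k, s ∩ spanningSets volume k := by
      rw [← inter_iUnion, iUnion_spanningSets, inter_univ]
    rw [← withDensity_apply _ hs, hU, hmono.measure_iUnion, ← hU]
    refine iSup_le fun k => ?_
    have hk := hs.inter (measurableSet_spanningSets volume k)
    rw [withDensity_apply _ hk]
    refine (this hk (fun x hx => (hf' x hx.1).mono inter_subset_left)
      (hinj.mono inter_subset_left) ?_).trans (measure_mono (image_mono inter_subset_left))
    exact ((measure_mono inter_subset_right).trans_lt (measure_spanningSets_lt_top volume k)).ne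
  refine le_of_forall_pos_le_add_two_mul_mul hfin fun η hη => ?_
  choose r hr hrA using fun A : EuclideanSpace ℝ (Fin d) →L[ℝ] F =>
    exists_approximatesLinearOn_le_euclideanHausdorffMeasure_image A hη
  obtain ⟨t, A, htd, htm, rfl, hta, htA⟩ :=
    exists_partition_approximatesLinearOn_normDet hs hf' hJ r hr hη
  have hcont : ContinuousOn f (⋃ n, t n) := fun x hx => (hf' x hx).continuousWithinAt
  calc ∫⁻ x in ⋃ n, t n, ENNReal.ofReal (f' x).normDet
      = ∑' n, ∫⁻ x in t n, ENNReal.ofReal (f' x).normDet := lintegral_iUnion htm htd _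
    _ ≤ ∑' n, (μHE[d] (f '' t n) + 2 * η * volume (t n)) := by
        refine ENNReal.tsum_le_tsum fun n => ?_
        calc ∫⁻ x in t n, ENNReal.ofReal (f' x).normDet
            ≤ ∫⁻ x in t n, (ENNReal.ofReal (A n).normDet + η) := by
              refine setLIntegral_mono (by fun_prop) fun x hx => ?_
              have := abs_le.1 (htA n x hx)
              rw [← ENNReal.ofReal_coe_nnreal,
                ← ENNReal.ofReal_add (LinearMap.normDet_nonneg (A n).toLinearMap) η.coe_nonneg]
              exact ENNReal.ofReal_le_ofReal (by linarith)
          _ = ENNReal.ofReal (A n).normDet * volume (t n) + η * volume (t n) := by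
              rw [setLIntegral_const, add_mul]
          _ ≤ μHE[d] (f '' t n) + η * volume (t n) + η * volume (t n) := by
              gcongr; exact hrA _ _ _ (hta n)
          _ = _ := by ring
    _ = ∑' n, μHE[d] (f '' t n) + 2 * η * volume (⋃ n, t n) := by
        rw [ENNReal.tsum_add, ENNReal.tsum_mul_left, measure_iUnion htd htm]
    _ = μHE[d] (f '' ⋃ n, t n) + 2 * η * volume (⋃ n, t n) := by
        rw [image_iUnion, measure_iUnion (f := fun n => f '' t n)]
        · intro m n hmn
          refine Set.disjoint_left.2 ?_
          rintro _ ⟨x, hx, rfl⟩ ⟨y, hy, hyx⟩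
          obtain rfl := hinj (mem_iUnion_of_mem n hy) (mem_iUnion_of_mem m hx) hyx
          exact Set.disjoint_left.1 (htd hmn) hx hy
        · exact fun n => (htm n).image_of_continuousOn_injOn (hcont.mono (subset_iUnion _ _))
            (hinj.mono (subset_iUnion _ _))

end Area

/-! ### Measurability of the Hausdorff measure of an image -/

section HausdorffMeasurability

open Set Filter Topology

variable {X : Type*} [MetricSpace X] [MeasurableSpace X] [BorelSpace X]

/-- The Hausdorff premeasure of dimension `d` at scale `r`, with coverings by open sets only. Open
coverings make it upper semicontinuous under perturbations of a compact set. -/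
noncomputable def hausdorffOpenContent (d : ℝ) (r : ℝ≥0∞) (s : Set X) : ℝ≥0∞ :=
  ⨅ (t : ℕ → Set X) (_ : s ⊆ ⋃ n, t n) (_ : ∀ n, IsOpen (t n) ∧ Metric.ediam (t n) ≤ r),
    ∑' n, Metric.ediam (t n) ^ d

omit [MeasurableSpace X] [BorelSpace X] in
theorem exists_isOpen_superset_ediam_rpow_le {d : ℝ} (hd : 0 < d) {t : Set X} {r ε : ℝ≥0∞}
    (ht : Metric.ediam t < r) (hε : 0 < ε) :
    ∃ u, t ⊆ u ∧ IsOpen u ∧ Metric.ediam u ≤ r ∧ Metric.ediam u ^ d ≤ Metric.ediam t ^ d + ε := by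
  have hlim : Tendsto (fun δ : ℝ => Metric.ediam t + 2 * ENNReal.ofReal δ) (𝓝[>] 0)
      (𝓝 (Metric.ediam t)) := by
    have h : Tendsto (fun δ : ℝ => Metric.ediam t + 2 * ENNReal.ofReal δ) (𝓝 0)
        (𝓝 (Metric.ediam t + 2 * ENNReal.ofReal 0)) :=
      tendsto_const_nhds.add
        (ENNReal.Tendsto.const_mul (ENNReal.tendsto_ofReal tendsto_id) (Or.inr (by simp)))
    simp only [ENNReal.ofReal_zero, mul_zero, add_zero] at h
    exact h.mono_left nhdsWithin_le_nhds
  have hpow : Tendsto (fun δ : ℝ => (Metric.ediam t + 2 * ENNReal.ofReal δ) ^ d) (𝓝[>] 0)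
      (𝓝 (Metric.ediam t ^ d)) := (ENNReal.continuous_rpow_const.tendsto _).comp hlim
  have hfin : Metric.ediam t ^ d ≠ ⊤ := ENNReal.rpow_ne_top_of_nonneg hd.le ht.ne_top
  have hlt : Metric.ediam t ^ d < Metric.ediam t ^ d + ε := ENNReal.lt_add_right hfin hε.ne'
  obtain ⟨δ, ⟨h1, h2⟩, h3⟩ := (((hlim.eventually_lt_const ht).and
    (hpow.eventually_lt_const hlt)).and self_mem_nhdsWithin).exists
  replace h3 : 0 < δ := h3
  have hdiam : Metric.ediam (Metric.thickening δ t) ≤ Metric.ediam t + 2 * ENNReal.ofReal δ := by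
    have := Metric.ediam_thickening_le (s := t) δ.toNNReal
    rwa [Real.coe_toNNReal _ h3.le] at this
  exact ⟨Metric.thickening δ t, Metric.self_subset_thickening h3 t, Metric.isOpen_thickening,
    hdiam.trans h1.le, (ENNReal.rpow_le_rpow hdiam hd.le).trans h2.le⟩

theorem hausdorffMeasure_eq_iSup_hausdorffOpenContent {d : ℝ} (hd : 0 < d) (s : Set X) :
    μH[d] s = ⨆ k : ℕ, hausdorffOpenContent d ((k : ℝ≥0∞) + 1)⁻¹ s := by
  have hsup : ∀ t : Set X, (⨆ _ : t.Nonempty, Metric.ediam t ^ d) = Metric.ediam t ^ d := by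
    intro t
    rcases t.eq_empty_or_nonempty with rfl | h
    · simp [hd]
    · simp [h]
  rw [Measure.hausdorffMeasure_apply]
  simp_rw [hsup]
  refine le_antisymm (iSup₂_le fun r hr => ?_) (iSup_le fun k => ?_)
  · obtain ⟨k, hk⟩ := ENNReal.exists_inv_nat_lt hr.ne'
    refine le_iSup_of_le k ?_
    refine le_iInf fun t => le_iInf fun hst => le_iInf fun ht => ?_
    refine iInf_le_of_le t (iInf_le_of_le hst (iInf_le_of_le (fun n => ?_) le_rfl))
    refine (ht n).2.trans (le_trans ?_ hk.le)
    exact ENNReal.inv_le_inv.2 le_self_add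
  · have hr0 : (0 : ℝ≥0∞) < ((k : ℝ≥0∞) + 1)⁻¹ := by
      simp [ENNReal.inv_pos]
    have hrt : ((k : ℝ≥0∞) + 1)⁻¹ ≠ ⊤ := by simp
    set r := ((k : ℝ≥0∞) + 1)⁻¹
    refine le_iSup₂_of_le (r / 2) (ENNReal.half_pos hr0.ne') ?_
    refine le_iInf fun t => le_iInf fun hst => le_iInf fun ht => ?_
    refine ENNReal.le_of_forall_pos_le_add fun ε hε _ => ?_
    obtain ⟨ε', hε', hsum⟩ := ENNReal.exists_pos_sum_of_countable (ι := ℕ)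
      (ENNReal.coe_ne_zero.2 hε.ne')
    choose u htu huo hur hud using fun n => exists_isOpen_superset_ediam_rpow_le hd
      ((ht n).trans_lt (ENNReal.half_lt_self hr0.ne' hrt))
      (ENNReal.coe_pos.2 (hε' n))
    calc hausdorffOpenContent d r s ≤ ∑' n, Metric.ediam (u n) ^ d :=
          iInf_le_of_le u (iInf_le_of_le (hst.trans (iUnion_mono htu))
            (iInf_le_of_le (fun n => ⟨huo n, hur n⟩) le_rfl))
      _ ≤ ∑' n, (Metric.ediam (t n) ^ d + ε' n) := ENNReal.tsum_le_tsum hud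
      _ = ∑' n, Metric.ediam (t n) ^ d + ∑' n, (ε' n : ℝ≥0∞) := ENNReal.tsum_add
      _ ≤ _ := by gcongr

variable {Θ Y : Type*} [TopologicalSpace Θ] [MeasurableSpace Θ] [OpensMeasurableSpace Θ]
  [TopologicalSpace Y]

omit [MeasurableSpace Θ] [OpensMeasurableSpace Θ] in
theorem IsCompact.isOpen_setOf_image_subset {Z : Type*} [TopologicalSpace Z] {f : Θ → Y → Z}
    (hf : Continuous (Function.uncurry f)) {K : Set Y} (hK : IsCompact K) {U : Set Z}
    (hU : IsOpen U) : IsOpen {θ | f θ '' K ⊆ U} := by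
  rw [isOpen_iff_eventually]
  intro θ₀ h₀
  have : ∀ᶠ θ in 𝓝 θ₀, ∀ y ∈ K, f θ y ∈ U := by
    refine hK.eventually_forall_of_forall_eventually fun y hy => ?_
    exact (hf.tendsto (θ₀, y)).eventually (hU.mem_nhds (h₀ (mem_image_of_mem _ hy)))
  filter_upwards [this] with θ hθ
  exact image_subset_iff.2 hθ

theorem measurable_hausdorffMeasure_image_of_isCompact {d : ℝ} (hd : 0 < d) {f : Θ → Y → X}
    (hf : Continuous (Function.uncurry f)) {K : Set Y} (hK : IsCompact K) :
    Measurable fun θ => μH[d] (f θ '' K) := by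
  simp_rw [hausdorffMeasure_eq_iSup_hausdorffOpenContent hd]
  refine .iSup fun k => measurable_of_Iio fun c => ?_
  refine IsOpen.measurableSet ?_
  have : (fun θ => hausdorffOpenContent d ((k : ℝ≥0∞) + 1)⁻¹ (f θ '' K)) ⁻¹' Iio c
      = ⋃ (t : ℕ → Set X) (_ : ∀ n, IsOpen (t n) ∧ Metric.ediam (t n) ≤ ((k : ℝ≥0∞) + 1)⁻¹)
        (_ : ∑' n, Metric.ediam (t n) ^ d < c), {θ | f θ '' K ⊆ ⋃ n, t n} := by
    ext θ
    simp only [hausdorffOpenContent, mem_preimage, mem_Iio, iInf_lt_iff, mem_iUnion, exists_prop]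
    refine exists_congr fun t => ?_
    constructor
    · rintro ⟨h1, h2, h3⟩; exact ⟨h2, h3, h1⟩
    · rintro ⟨h1, h2, h3⟩; exact ⟨h3, h1, h2⟩
  rw [this]
  exact isOpen_iUnion fun t => isOpen_iUnion fun ht => isOpen_iUnion fun _ =>
    hK.isOpen_setOf_image_subset hf (isOpen_iUnion fun n => (ht n).1)

/-- Hausdorff measures of the continuous images of a fixed σ-compact set depend measurably on the
map: on a compact set, each premeasure with open coverings is upper semicontinuous. -/
theorem measurable_euclideanHausdorffMeasure_image {d : ℕ} (hd : 0 < d) {f : Θ → Y → X}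
    (hf : Continuous (Function.uncurry f)) {M : Set Y} (hM : IsSigmaCompact M) :
    Measurable fun θ => μHE[d] (f θ '' M) := by
  obtain ⟨K, hK, rfl⟩ := hM
  have h : ∀ θ, μHE[d] (f θ '' ⋃ n, K n) = ⨆ n, μHE[d] (f θ '' accumulate K n) := by
    intro θ
    rw [← iUnion_accumulate, image_iUnion,
      Monotone.measure_iUnion fun i j hij => image_mono (monotone_accumulate hij)]
  simp_rw [h]
  refine .iSup fun n => ?_
  simp_rw [Measure.euclideanHausdorffMeasure_def, Measure.smul_apply]
  exact (measurable_hausdorffMeasure_image_of_isCompact (by exact_mod_cast hd) hf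
    (isCompact_accumulate hK n)).const_smul _

end HausdorffMeasurability

/-! ### Submanifolds as measures on frames -/

section FrameMeasure

open Set Filter Topology

variable {d : ℕ} {F : Type*} [NormedAddCommGroup F] [InnerProductSpace ℝ F]

theorem continuous_det_gram : Continuous fun v : Fin d → F => (Matrix.gram ℝ v).det := by
  refine Continuous.matrix_det (continuous_matrix fun i j => ?_)
  simp only [Matrix.gram_apply]
  fun_prop

theorem LinearMap.normDet_eq_sqrt_det_gram (A : EuclideanSpace ℝ (Fin d) →ₗ[ℝ] F) :
    A.normDet = √(Matrix.gram ℝ fun a => A (EuclideanSpace.basisFun (Fin d) ℝ a)).det := by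
  rw [← Real.sqrt_sq A.normDet_nonneg]
  congr 1
  exact A.normDet_sq_eq_det_gram (EuclideanSpace.basisFun (Fin d) ℝ)

theorem ContinuousOn.measurableSet_inter_preimage {α β : Type*} [TopologicalSpace α]
    [MeasurableSpace α] [OpensMeasurableSpace α] [TopologicalSpace β] [MeasurableSpace β]
    [BorelSpace β] {f : α → β} {s : Set α} (hf : ContinuousOn f s) (hs : MeasurableSet s)
    {t : Set β} (ht : MeasurableSet t) : MeasurableSet (s ∩ f ⁻¹' t) := by
  have h := hs.subtype_image (hf.domRestrict.measurable ht)
  convert h using 1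
  ext x
  simp [and_comm]

variable [FiniteDimensional ℝ F] [MeasurableSpace F] [BorelSpace F]
  {k : ℕ}

/-- The Jacobian of a composition, integrated over a parametrized set, bounds the volume of the
image of that set under a Lipschitz map which is differentiable almost everywhere on the set. -/
theorem euclideanHausdorffMeasure_image_image_le {U : Set (EuclideanSpace ℝ (Fin d))}
    (hU : MeasurableSet U) {φ : EuclideanSpace ℝ (Fin d) → F}
    {φ' : EuclideanSpace ℝ (Fin d) → EuclideanSpace ℝ (Fin d) →L[ℝ] F}
    (hφ : ∀ u ∈ U, HasFDerivWithinAt φ (φ' u) U u) (hφm : ContinuousOn φ U) (hφ'm : Measurable φ')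
    {N : F → EuclideanSpace ℝ (Fin k)} {D : F → F →L[ℝ] EuclideanSpace ℝ (Fin k)} {K : ℝ≥0}
    (hN : LipschitzWith K N) (hD : Measurable fun p : F × F => D p.1 p.2)
    (hND : ∀ᵐ u ∂volume.restrict U, HasFDerivAt N (D (φ u)) (φ u)) :
    μHE[d] (N '' (φ '' U)) ≤ ∫⁻ u in U, ENNReal.ofReal (D (φ u) ∘L φ' u).normDet := by
  classical
  have hJ : Measurable fun u => (φ' u).normDet := by
    simp_rw [LinearMap.normDet_eq_sqrt_det_gram]
    refine (continuous_det_gram.measurable.comp (measurable_pi_lambda _ fun a => ?_)).sqrt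
    exact (ContinuousLinearMap.measurable_apply _).comp hφ'm
  -- `B` contains the points of `U` where `N` may fail to be differentiable
  set B := toMeasurable (volume.restrict U) {u | ¬ HasFDerivAt N (D (φ u)) (φ u)} with hB
  have hBm : MeasurableSet B := measurableSet_toMeasurable _ _
  have hB0 : volume (U ∩ B) = 0 := by
    rw [inter_comm, ← Measure.restrict_apply hBm, hB, measure_toMeasurable]
    exact hND
  have hgood : ∀ u ∈ U \ B, HasFDerivAt N (D (φ u)) (φ u) := fun u hu => by
    by_contra h
    exact hu.2 (subset_toMeasurable _ _ h)
  have hVm : MeasurableSet (U \ B) := hU.diff hBm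
  set f' : EuclideanSpace ℝ (Fin d) → EuclideanSpace ℝ (Fin d) →L[ℝ] EuclideanSpace ℝ (Fin k) :=
    fun u => if u ∈ U \ B then D (φ u) ∘L φ' u else 0 with hf'
  have hφU : Measurable (U.piecewise φ 0) :=
    hφm.measurable_piecewise continuousOn_const hU
  have hJ' : Measurable fun u => (f' u).normDet := by
    simp_rw [LinearMap.normDet_eq_sqrt_det_gram]
    refine (continuous_det_gram.measurable.comp (measurable_pi_lambda _ fun a => ?_)).sqrt
    have : (fun u => (f' u).toLinearMap (EuclideanSpace.basisFun (Fin d) ℝ a)) =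
        fun u => if u ∈ U \ B then D (U.piecewise φ 0 u) (φ' u (EuclideanSpace.basisFun _ ℝ a))
          else 0 := by
      ext1 u
      by_cases hu : u ∈ U \ B
      · simp only [hf', hu, if_true, piecewise_eq_of_mem _ _ _ hu.1]
        rfl
      · simp only [hf', hu, if_false]
        rfl
    rw [this]
    refine Measurable.ite hVm ?_ measurable_const
    exact hD.comp (hφU.prodMk ((ContinuousLinearMap.measurable_apply _).comp hφ'm))
  have h1 : μHE[d] ((N ∘ φ) '' (U \ B)) ≤ ∫⁻ u in U \ B, ENNReal.ofReal (f' u).normDet := by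
    refine euclideanHausdorffMeasure_image_le_lintegral_normDet hVm (fun u hu => ?_) hJ'
    simp only [hf', hu, if_true]
    exact (hgood u hu).comp_hasFDerivWithinAt u ((hφ u hu.1).mono sdiff_subset)
  have h2 : μHE[d] ((N ∘ φ) '' (U ∩ B)) = 0 := by
    have h3 : μHE[d] (φ '' (U ∩ B)) = 0 := by
      refine le_antisymm ((euclideanHausdorffMeasure_image_le_lintegral_normDet (hU.inter hBm)
        (fun u hu => (hφ u hu.1).mono inter_subset_left) hJ).trans_eq ?_) zero_le
      exact setLIntegral_measure_zero _ _ hB0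
    refine le_antisymm ((euclideanHausdorffMeasure_image_le_of_dist_le (f := N ∘ φ) (g := φ) (K := K)
      d fun x _ y _ => hN.dist_le_mul _ _).trans ?_) zero_le
    rw [h3, mul_zero]
  calc μHE[d] (N '' (φ '' U)) = μHE[d] ((N ∘ φ) '' (U \ B) ∪ (N ∘ φ) '' (U ∩ B)) := by
        rw [← image_union, sdiff_union_inter, image_comp]
    _ ≤ ∫⁻ u in U \ B, ENNReal.ofReal (f' u).normDet :=
        (measure_union_le _ _).trans (by rw [h2, add_zero]; exact h1)
    _ = ∫⁻ u in U \ B, ENNReal.ofReal (D (φ u) ∘L φ' u).normDet :=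
        setLIntegral_congr_fun hVm fun u hu => by simp only [hf', hu, if_true]
    _ ≤ _ := lintegral_mono_set sdiff_subset

/-- A submanifold `M` is represented by a measure on the space of points with `d` attached vectors:
the sum of the images of Lebesgue measure under countably many local parametrizations `φ`, with the
partial derivatives of `φ` at `u` attached to the point `φ u`. The root of the Gram determinant of
the attached vectors integrates to at most the volume of `M`, and the volume of the image of `M`
under a Lipschitz map is at most the corresponding integral for the transformed vectors. -/
theorem exists_frameMeasure {H : Type*} [TopologicalSpace H]
    (I : ModelWithCorners ℝ (EuclideanSpace ℝ (Fin d)) H)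
    (M : Set F) [ChartedSpace H M] [IsManifold I ∞ M]
    (hM : ContMDiff I 𝓘(ℝ, F) ∞ (Subtype.val : M → F)) [Nonempty M] :
    ∃ m : Measure (F × (Fin d → F)), SFinite m ∧
      ∫⁻ p, ENNReal.ofReal √(Matrix.gram ℝ p.2).det ∂m ≤ μHE[d] M ∧
      ∀ (k : ℕ) (N : F → EuclideanSpace ℝ (Fin k)) (D : F → F →L[ℝ] EuclideanSpace ℝ (Fin k))
        (K : ℝ≥0), LipschitzWith K N → (Measurable fun p : F × F => D p.1 p.2) →
        (∀ᵐ p ∂m, HasFDerivAt N (D p.1) p.1) →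
        μHE[d] (N '' M) ≤
          ∫⁻ p, ENNReal.ofReal √(Matrix.gram ℝ fun a => D p.1 (p.2 a)).det ∂m := by
  classical
  -- countably many charts, with domains made disjoint
  obtain ⟨S, hSc, hSU⟩ := TopologicalSpace.countable_cover_nhds
    fun x : M => extChartAt_source_mem_nhds (I := I) x
  have hSne : S.Nonempty := by
    by_contra h
    rw [not_nonempty_iff_eq_empty] at h
    subst h
    simp only [mem_empty_iff_false, iUnion_of_empty, iUnion_empty] at hSU
    exact empty_ne_univ hSU
  obtain ⟨c, rfl⟩ := hSc.exists_eq_range hSne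
  set src : ℕ → Set M := fun n => (extChartAt I (c n)).source with hsrc
  have hcov : ⋃ n, src n = univ := by rwa [biUnion_range] at hSU
  set Q : ℕ → Set M := disjointed src with hQ
  have hQm : ∀ n, MeasurableSet (Q n) :=
    MeasurableSet.disjointed fun n => (isOpen_extChartAt_source (c n)).measurableSet
  have hQs : ∀ n, Q n ⊆ src n := fun n => disjointed_subset src n
  set T : ℕ → Set (EuclideanSpace ℝ (Fin d)) := fun n => (extChartAt I (c n)).target with hT
  have hTm : ∀ n, MeasurableSet (T n) := fun n => by
    simp only [hT, extChartAt_target]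
    exact (((chartAt H (c n)).open_target.preimage I.continuous_symm).measurableSet).inter
      I.isClosed_range.measurableSet
  set ψ : ℕ → EuclideanSpace ℝ (Fin d) → M := fun n => (extChartAt I (c n)).symm with hψ
  have hψc : ∀ n, ContinuousOn (ψ n) (T n) := fun n => continuousOn_extChartAt_symm (c n)
  set φ : ℕ → EuclideanSpace ℝ (Fin d) → F := fun n u => ψ n u with hφ
  have hφd : ∀ n, ContDiffOn ℝ ∞ (φ n) (T n) := fun n => by
    rw [← contMDiffOn_iff_contDiffOn]
    exact hM.comp_contMDiffOn (contMDiffOn_extChartAt_symm (c n))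
  have hφinj : ∀ n, InjOn (φ n) (T n) := fun n =>
    Subtype.val_injective.comp_injOn (extChartAt I (c n)).symm.injOn
  set U : ℕ → Set (EuclideanSpace ℝ (Fin d)) := fun n => T n ∩ ψ n ⁻¹' Q n with hU
  have hUT : ∀ n, U n ⊆ T n := fun n => inter_subset_left
  have hUm : ∀ n, MeasurableSet (U n) := fun n =>
    (hψc n).measurableSet_inter_preimage (hTm n) (hQm n)
  have hφU : ∀ n, φ n '' U n = Subtype.val '' Q n := by
    intro n
    have : ψ n '' U n = Q n := by
      refine Subset.antisymm (image_subset_iff.2 inter_subset_right) fun x hx => ?_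
      refine ⟨extChartAt I (c n) x, ⟨(extChartAt I (c n)).map_source (hQs n hx), ?_⟩,
        (extChartAt I (c n)).left_inv (hQs n hx)⟩
      simp only [mem_preimage, hψ, (extChartAt I (c n)).left_inv (hQs n hx), hx]
    rw [← this, image_image]
  have hφUM : ⋃ n, φ n '' U n = M := by
    simp_rw [hφU]
    rw [← image_iUnion, hQ, iUnion_disjointed, hcov, image_univ, Subtype.range_coe]
  set φ' : ℕ → EuclideanSpace ℝ (Fin d) → EuclideanSpace ℝ (Fin d) →L[ℝ] F := fun n =>
    (T n).piecewise (fderivWithin ℝ (φ n) (T n)) 0 with hφ'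
  have hφ'm : ∀ n, Measurable (φ' n) := fun n =>
    ((hφd n).continuousOn_fderivWithin (uniqueDiffOn_extChartAt_target (c n))
      (by simp)).measurable_piecewise continuousOn_const (hTm n)
  have hder : ∀ n, ∀ u ∈ U n, HasFDerivWithinAt (φ n) (φ' n u) (U n) u := fun n u hu => by
    simp only [hφ', piecewise_eq_of_mem _ _ _ (hUT n hu)]
    exact (((hφd n).differentiableOn (by simp)) u (hUT n hu)).hasFDerivWithinAt.mono (hUT n)
  -- `φ` is only known to be measurable on the chart target, so it is cut off outside of it
  set φ₀ : ℕ → EuclideanSpace ℝ (Fin d) → F := fun n => (T n).piecewise (φ n) 0 with hφ₀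
  have hφ₀m : ∀ n, Measurable (φ₀ n) := fun n =>
    (hφd n).continuousOn.measurable_piecewise continuousOn_const (hTm n)
  have hφ₀U : ∀ n, ∀ u ∈ U n, φ₀ n u = φ n u := fun n u hu =>
    piecewise_eq_of_mem _ _ _ (hUT n hu)
  set w : ℕ → EuclideanSpace ℝ (Fin d) → F × (Fin d → F) := fun n u =>
    (φ₀ n u, fun a => φ' n u (EuclideanSpace.basisFun (Fin d) ℝ a)) with hw
  have hwm : ∀ n, Measurable (w n) := fun n =>
    (hφ₀m n).prodMk (measurable_pi_lambda _ fun a =>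
      (ContinuousLinearMap.measurable_apply _).comp (hφ'm n))
  refine ⟨Measure.sum fun n => (volume.restrict (U n)).map (w n), inferInstance, ?_, ?_⟩
  · rw [lintegral_sum_measure]
    calc _ = ∑' n, ∫⁻ u in U n, ENNReal.ofReal (φ' n u).normDet := by
          refine tsum_congr fun n => ?_
          rw [lintegral_map ?_ (hwm n)]
          · simp_rw [LinearMap.normDet_eq_sqrt_det_gram]
            rfl
          · exact (continuous_det_gram.measurable.comp measurable_snd).sqrt.ennreal_ofReal
      _ ≤ ∑' n, μHE[d] (φ n '' U n) := by
          refine ENNReal.tsum_le_tsum fun n => ?_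
          refine lintegral_normDet_le_euclideanHausdorffMeasure_image (hUm n) (hder n) ?_
            ((hφinj n).mono (hUT n))
          simp_rw [LinearMap.normDet_eq_sqrt_det_gram]
          exact (continuous_det_gram.measurable.comp (measurable_snd.comp (hwm n))).sqrt
      _ = μHE[d] (⋃ n, φ n '' U n) := by
          refine (measure_iUnion ?_ fun n => ?_).symm
          · intro i j hij
            simp only [Function.onFun, hφU]
            exact (disjoint_image_iff Subtype.val_injective).2 (disjoint_disjointed src hij)
          · exact (hUm n).image_of_continuousOn_injOn ((hφd n).continuousOn.mono (hUT n))
              ((hφinj n).mono (hUT n))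
      _ = μHE[d] M := by rw [hφUM]
  · intro k N D K hN hD hND
    rw [Measure.ae_sum_iff] at hND
    rw [lintegral_sum_measure]
    calc μHE[d] (N '' M) = μHE[d] (⋃ n, N '' (φ n '' U n)) := by rw [← image_iUnion, hφUM]
      _ ≤ ∑' n, μHE[d] (N '' (φ n '' U n)) := measure_iUnion_le _
      _ ≤ _ := by
          refine ENNReal.tsum_le_tsum fun n => ?_
          have hae := ae_of_ae_map (hwm n).aemeasurable (hND n)
          refine (euclideanHausdorffMeasure_image_image_le (hUm n) (hder n)
            ((hφd n).continuousOn.mono (hUT n)) (hφ'm n) hN hD ?_).trans_eq ?_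
          · filter_upwards [hae, ae_restrict_mem (hUm n)] with u hu huU
            rwa [← hφ₀U n u huU]
          · rw [lintegral_map ?_ (hwm n)]
            · refine setLIntegral_congr_fun (hUm n) fun u hu => ?_
              simp only [LinearMap.normDet_eq_sqrt_det_gram, hw, hφ₀U n u hu]
              rfl
            · refine (continuous_det_gram.measurable.comp
                (measurable_pi_lambda _ fun a => ?_)).sqrt.ennreal_ofReal
              exact hD.comp (measurable_fst.prodMk ((measurable_pi_apply a).comp measurable_snd))

theorem isSigmaCompact_of_chartedSpace {X H : Type*} [TopologicalSpace X]
    [SecondCountableTopology X] [TopologicalSpace H]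
    (I : ModelWithCorners ℝ (EuclideanSpace ℝ (Fin d)) H) (M : Set X) [ChartedSpace H M] :
    IsSigmaCompact M := by
  have := Manifold.locallyCompact_of_finiteDimensional (M := M) I
  exact isSigmaCompact_iff_sigmaCompactSpace.2 inferInstance

end FrameMeasure

/-! ### Expected Gram determinants of random matrices -/

section RandomGram

theorem EuclideanSpace.gram_toLp_apply {ι : Type*} {N : ℕ} (x : ι → Fin N → ℝ) (a b : ι) :
    Matrix.gram ℝ (fun a => (WithLp.toLp 2 (x a) : EuclideanSpace ℝ (Fin N))) a b =
      ∑ i, x a i * x b i := by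
  simp [Matrix.gram_apply, PiLp.inner_apply, mul_comm]

theorem det_gram_nonneg {ι F : Type*} [Fintype ι] [DecidableEq ι] [NormedAddCommGroup F]
    [InnerProductSpace ℝ F] (v : ι → F) : 0 ≤ (Matrix.gram ℝ v).det :=
  (Matrix.posSemidef_gram ℝ v).det_nonneg

/-- Expansion of a Gram determinant over the choices of one row for each column: only the
injective choices contribute. -/
theorem det_gram_toLp_eq_sum_embedding {d N : ℕ} (x : Fin d → Fin N → ℝ) :
    (Matrix.gram ℝ fun a => (WithLp.toLp 2 (x a) : EuclideanSpace ℝ (Fin N))).det =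
      ∑ f : Fin d ↪ Fin N, ∑ σ : Equiv.Perm (Fin d),
        (Equiv.Perm.sign σ : ℝ) * ∏ a, x (σ a) (f a) * x a (f a) := by
  have h1 : (Matrix.gram ℝ fun a => (WithLp.toLp 2 (x a) : EuclideanSpace ℝ (Fin N))).det =
      ∑ f : Fin d → Fin N, ∑ σ : Equiv.Perm (Fin d),
        (Equiv.Perm.sign σ : ℝ) * ∏ a, x (σ a) (f a) * x a (f a) := by
    rw [Matrix.det_apply', Finset.sum_comm]
    refine Finset.sum_congr rfl fun σ _ => ?_
    simp_rw [EuclideanSpace.gram_toLp_apply]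
    rw [Finset.prod_univ_sum, Finset.mul_sum, Fintype.piFinset_univ]
  have h2 : ∀ f : Fin d → Fin N, ¬ Function.Injective f → ∑ σ : Equiv.Perm (Fin d),
      (Equiv.Perm.sign σ : ℝ) * ∏ a, x (σ a) (f a) * x a (f a) = 0 := by
    intro f hf
    have hdet : (Matrix.of fun b a => x b (f a)).det = 0 := by
      simp only [Function.Injective, not_forall] at hf
      obtain ⟨a, a', haa, hne⟩ := hf
      exact Matrix.det_zero_of_column_eq hne fun b => by simp [haa]
    rw [Matrix.det_apply'] at hdet
    simp only [Matrix.of_apply] at hdet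
    simp_rw [Finset.prod_mul_distrib, ← mul_assoc]
    rw [← Finset.sum_mul, hdet, zero_mul]
  rw [h1, ← Finset.sum_subset (Finset.subset_univ
    (Finset.univ.image fun f : Fin d ↪ Fin N => (f : Fin d → Fin N))) fun f _ hf => h2 f ?_]
  · rw [Finset.sum_image fun f _ g _ h => DFunLike.coe_injective h]
  · intro hinj
    exact hf (Finset.mem_image.2 ⟨⟨f, hinj⟩, Finset.mem_univ _, rfl⟩)

theorem measurePreserving_pi_comp_embedding {R : Type*} [MeasurableSpace R] {d N : ℕ}
    (ν : Measure R) [IsProbabilityMeasure ν] (f : Fin d ↪ Fin N) :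
    MeasurePreserving (fun (p : Fin N → R) a => p (f a)) (Measure.pi fun _ => ν)
      (Measure.pi fun _ => ν) := by
  refine ⟨by fun_prop, ?_⟩
  have h := (iIndepFun_pi (μ := fun _ : Fin N => ν) (X := fun _ => id)
    fun _ => aemeasurable_id).precomp f.injective
  have h2 := h.map_fun_eq_pi_map fun a =>
    (measurable_pi_apply (f a)).aemeasurable
  refine h2.trans ?_
  congr 1
  ext1 a
  exact (measurePreserving_eval (fun _ : Fin N => ν) (f a)).map_eq

/-- For a matrix with `N` independent rows in `ℝᵈ`, all with second moment matrix `S`, the expected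
Gram determinant of the columns is `N (N - 1) ⋯ (N - d + 1) * det S`. -/
theorem integral_det_gram_of_iid_rows {R : Type*} [MeasurableSpace R] {d : ℕ} (N : ℕ)
    (ν : Measure R) [IsProbabilityMeasure ν] (g : R → Fin d → ℝ) (S : Matrix (Fin d) (Fin d) ℝ)
    (hint : ∀ a b, Integrable (fun r => g r a * g r b) ν)
    (hS : ∀ a b, ∫ r, g r a * g r b ∂ν = S a b) :
    Integrable (fun p : Fin N → R => (Matrix.gram ℝ fun a =>
      (WithLp.toLp 2 fun i => g (p i) a : EuclideanSpace ℝ (Fin N))).det) (Measure.pi fun _ => ν) ∧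
    ∫ p : Fin N → R, (Matrix.gram ℝ fun a =>
      (WithLp.toLp 2 fun i => g (p i) a : EuclideanSpace ℝ (Fin N))).det ∂(Measure.pi fun _ => ν)
      = N.descFactorial d * S.det := by
  simp_rw [det_gram_toLp_eq_sum_embedding]
  have hI : ∀ (f : Fin d ↪ Fin N) (σ : Equiv.Perm (Fin d)),
      Integrable (fun p : Fin N → R => ∏ a, g (p (f a)) (σ a) * g (p (f a)) a)
        (Measure.pi fun _ => ν) := fun f σ =>
    (measurePreserving_pi_comp_embedding ν f).integrable_comp_of_integrable
      (Integrable.fintype_prod (f := fun a r => g r (σ a) * g r a) fun a => hint _ _)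
  have hE : ∀ (f : Fin d ↪ Fin N) (σ : Equiv.Perm (Fin d)),
      ∫ p : Fin N → R, ∏ a, g (p (f a)) (σ a) * g (p (f a)) a ∂(Measure.pi fun _ => ν)
        = ∏ a, S (σ a) a := by
    intro f σ
    have hmp := measurePreserving_pi_comp_embedding ν f
    have h := integral_map (μ := Measure.pi fun _ : Fin N => ν) hmp.measurable.aemeasurable
      (f := fun p : Fin d → R => ∏ a, g (p a) (σ a) * g (p a) a) (by
        rw [hmp.map_eq]
        exact (Integrable.fintype_prod (f := fun a r => g r (σ a) * g r a)
          fun a => hint _ _).aestronglyMeasurable)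
    rw [hmp.map_eq] at h
    rw [← h, integral_fintype_prod_eq_prod (fun a r => g r (σ a) * g r a)]
    exact Finset.prod_congr rfl fun a _ => hS _ _
  constructor
  · exact integrable_finsetSum _ fun f _ => integrable_finsetSum _ fun σ _ =>
      (hI f σ).const_mul _
  · rw [integral_finsetSum _ fun f _ => integrable_finsetSum _ fun σ _ => (hI f σ).const_mul _]
    simp_rw [integral_finsetSum _ fun σ _ => (hI _ σ).const_mul _, integral_const_mul, hE]
    rw [Finset.sum_const, Finset.card_univ, Fintype.card_embedding_eq, nsmul_eq_mul,
      Matrix.det_apply', Fintype.card_fin, Fintype.card_fin]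

theorem lintegral_det_gram_of_iid_rows {R : Type*} [MeasurableSpace R] {d : ℕ} (N : ℕ)
    (ν : Measure R) [IsProbabilityMeasure ν] (g : R → Fin d → ℝ) (S : Matrix (Fin d) (Fin d) ℝ)
    (hint : ∀ a b, Integrable (fun r => g r a * g r b) ν)
    (hS : ∀ a b, ∫ r, g r a * g r b ∂ν = S a b) :
    ∫⁻ p : Fin N → R, ENNReal.ofReal (Matrix.gram ℝ fun a =>
      (WithLp.toLp 2 fun i => g (p i) a : EuclideanSpace ℝ (Fin N))).det ∂(Measure.pi fun _ => ν)
      = ENNReal.ofReal (N.descFactorial d * S.det) := by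
  obtain ⟨h1, h2⟩ := integral_det_gram_of_iid_rows N ν g S hint hS
  rw [← ofReal_integral_eq_lintegral_ofReal h1 (ae_of_all _ fun _ => det_gram_nonneg _), h2]

/-! ### Gaussian rows -/

theorem memLp_sum_mul_gaussian {m : ℕ} (s : ℝ≥0) (v : Fin m → ℝ) :
    MemLp (fun w : Fin m → ℝ => ∑ j, w j * v j) 2 (Measure.pi fun _ => gaussianReal 0 s) := by
  refine memLp_finsetSum _ fun j _ => ?_
  have h : MemLp (fun w : Fin m → ℝ => w j) 2 (Measure.pi fun _ => gaussianReal 0 s) :=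
    (memLp_id_gaussianReal (μ := 0) (v := s) 2).comp_measurePreserving
      (measurePreserving_eval (fun _ : Fin m => gaussianReal 0 s) j)
  exact h.mul_const _

theorem integral_mul_gaussian_pi {m : ℕ} (s : ℝ≥0) (i j : Fin m) :
    ∫ w : Fin m → ℝ, w i * w j ∂(Measure.pi fun _ => gaussianReal 0 s) =
      if i = j then (s : ℝ) else 0 := by
  split_ifs with h
  · subst h
    rw [integral_comp_eval (μ := fun _ : Fin m => gaussianReal 0 s) (i := i)
      (f := fun t : ℝ => t * t) (by fun_prop)]
    have h1 := variance_fun_id_gaussianReal (μ := 0) (v := s)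
    rw [variance_eq_integral (by fun_prop)] at h1
    simpa [pow_two] using h1
  · have hind : IndepFun (fun w : Fin m → ℝ => w i) (fun w => w j)
        (Measure.pi fun _ => gaussianReal 0 s) :=
      (iIndepFun_pi (μ := fun _ : Fin m => gaussianReal 0 s) (X := fun _ => id)
        fun _ => aemeasurable_id).indepFun h
    have h1 : ∀ i : Fin m, ∫ w : Fin m → ℝ, w i ∂(Measure.pi fun _ => gaussianReal 0 s) = 0 := by
      intro i
      rw [integral_comp_eval (μ := fun _ : Fin m => gaussianReal 0 s) (i := i)
        (f := fun t : ℝ => t) (by fun_prop)]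
      simp
    rw [hind.integral_fun_mul_eq_mul_integral
      (measurable_pi_apply i).aestronglyMeasurable (measurable_pi_apply j).aestronglyMeasurable, h1, zero_mul]

theorem integral_sum_mul_sum_gaussian {m : ℕ} (s : ℝ≥0) (v u : EuclideanSpace ℝ (Fin m)) :
    ∫ w : Fin m → ℝ, (∑ j, w j * v j) * (∑ j, w j * u j) ∂(Measure.pi fun _ => gaussianReal 0 s) =
      s * inner ℝ v u := by
  have hw : ∀ i : Fin m, MemLp (fun w : Fin m → ℝ => w i) 2
      (Measure.pi fun _ => gaussianReal 0 s) := fun i =>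
    (memLp_id_gaussianReal (μ := 0) (v := s) 2).comp_measurePreserving
      (measurePreserving_eval (fun _ : Fin m => gaussianReal 0 s) i)
  have hint : ∀ i j : Fin m, Integrable (fun w : Fin m → ℝ => v i * u j * (w i * w j))
      (Measure.pi fun _ => gaussianReal 0 s) := fun i j =>
    ((hw i).integrable_mul (hw j)).const_mul _
  have hexp : ∀ w : Fin m → ℝ, (∑ j, w j * v j) * (∑ j, w j * u j) =
      ∑ i, ∑ j, v i * u j * (w i * w j) := by
    intro w
    rw [Finset.sum_mul_sum]
    exact Finset.sum_congr rfl fun i _ => Finset.sum_congr rfl fun j _ => by ring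
  simp_rw [hexp]
  rw [integral_finsetSum _ fun i _ => integrable_finsetSum _ fun j _ => hint i j]
  simp_rw [integral_finsetSum _ fun j _ => hint _ j, integral_const_mul, integral_mul_gaussian_pi]
  simp [PiLp.inner_apply, Finset.mul_sum, mul_comm]

/-- The law of one row of weights together with the corresponding bias. -/
noncomputable def rowLaw (m : ℕ) (s Cb : ℝ≥0) : Measure ((Fin m → ℝ) × ℝ) :=
  (Measure.pi fun _ => gaussianReal 0 s).prod (gaussianReal 0 Cb)

instance (m : ℕ) (s Cb : ℝ≥0) : IsProbabilityMeasure (rowLaw m s Cb) := by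
  unfold rowLaw; infer_instance

theorem measurePreserving_neg_rowLaw (m : ℕ) (s Cb : ℝ≥0) :
    MeasurePreserving (fun r : (Fin m → ℝ) × ℝ => -r) (rowLaw m s Cb) (rowLaw m s Cb) := by
  have hg : ∀ s : ℝ≥0, MeasurePreserving (fun x : ℝ => -x) (gaussianReal 0 s) (gaussianReal 0 s) :=
    fun s => ⟨measurable_neg, by rw [gaussianReal_map_neg, neg_zero]⟩
  have hp : MeasurePreserving (fun w : Fin m → ℝ => -w) (Measure.pi fun _ => gaussianReal 0 s)
      (Measure.pi fun _ => gaussianReal 0 s) :=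
    measurePreserving_pi _ _ fun _ => hg s
  exact hp.prod (hg Cb)

theorem ae_rowLaw_ne_zero {m : ℕ} {s Cb : ℝ≥0} (hCb : 0 < Cb) (h : Fin m → ℝ) :
    ∀ᵐ r ∂rowLaw m s Cb, (∑ j, r.1 j * h j) + r.2 ≠ 0 := by
  have : NullSingletonClass (gaussianReal 0 Cb) := nullSingletonClass_gaussianReal hCb.ne'
  have hm : MeasurableSet {r : (Fin m → ℝ) × ℝ | (∑ j, r.1 j * h j) + r.2 = 0} :=
    (measurableSet_singleton (0 : ℝ)).preimage (by fun_prop)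
  change rowLaw m s Cb {r | ¬ (∑ j, r.1 j * h j) + r.2 ≠ 0} = 0
  simp only [not_not, rowLaw]
  rw [Measure.prod_apply hm]
  refine (lintegral_congr fun w => ?_).trans lintegral_zero
  have : Prod.mk w ⁻¹' {r : (Fin m → ℝ) × ℝ | (∑ j, r.1 j * h j) + r.2 = 0}
      = {-∑ j, w j * h j} := by
    ext b
    simp only [Set.mem_preimage, Set.mem_ofPred_eq, Set.mem_singleton_iff]
    constructor <;> intro h <;> linarith
  rw [this, measure_singleton]

/-- By symmetry, half of the integral of an even function comes from the half-space where an odd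
function is positive. -/
theorem integral_ite_pos_of_even {E : Type*} [AddGroup E] [MeasurableSpace E] [MeasurableNeg E]
    {ν : Measure E} (hν : MeasurePreserving (fun x : E => -x) ν ν) {q l : E → ℝ}
    (hq : Integrable q ν) (hqe : ∀ x, q (-x) = q x) (hl : Measurable l) (hlo : ∀ x, l (-x) = - l x)
    (hl0 : ∀ᵐ x ∂ν, l x ≠ 0) : ∫ x, (if 0 < l x then q x else 0) ∂ν = 2⁻¹ * ∫ x, q x ∂ν := by
  have hpos : MeasurableSet {x | 0 < l x} := measurableSet_lt measurable_const hl
  have hneg : MeasurableSet {x | l x < 0} := measurableSet_lt hl measurable_const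
  have h1 : ∫ x, (if l x < 0 then q x else 0) ∂ν = ∫ x, (if 0 < l x then q x else 0) ∂ν := by
    rw [← (show MeasurePreserving (MeasurableEquiv.neg E) ν ν from hν).integral_comp']
    refine integral_congr_ae (ae_of_all _ fun x => ?_)
    simp [hqe, hlo]
  have h2 : ∫ x, q x ∂ν = ∫ x, ((if 0 < l x then q x else 0) + if l x < 0 then q x else 0) ∂ν := by
    refine integral_congr_ae ?_
    filter_upwards [hl0] with x hx
    rcases lt_or_gt_of_ne hx with h | h
    · simp [h, h.not_gt]
    · simp [h, h.not_gt]
  have i1 : Integrable (fun x => if 0 < l x then q x else 0) ν := hq.indicator hpos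
  have i2 : Integrable (fun x => if l x < 0 then q x else 0) ν := hq.indicator hneg
  rw [h2, integral_add i1 i2, h1]
  ring

variable {m d : ℕ} (s Cb : ℝ≥0)

theorem integrable_sum_mul_sum_rowLaw (v u : Fin m → ℝ) :
    Integrable (fun r : (Fin m → ℝ) × ℝ => (∑ j, r.1 j * v j) * (∑ j, r.1 j * u j))
      (rowLaw m s Cb) :=
  ((memLp_sum_mul_gaussian s v).integrable_mul (memLp_sum_mul_gaussian s u)).comp_fst _

theorem integral_sum_mul_sum_rowLaw (v u : EuclideanSpace ℝ (Fin m)) :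
    ∫ r : (Fin m → ℝ) × ℝ, (∑ j, r.1 j * v j) * (∑ j, r.1 j * u j) ∂rowLaw m s Cb
      = s * inner ℝ v u := by
  have hfst := measurePreserving_fst (μ := Measure.pi fun _ : Fin m => gaussianReal 0 s)
    (ν := gaussianReal 0 Cb)
  have h := integral_map (μ := rowLaw m s Cb) hfst.measurable.aemeasurable
    (f := fun w : Fin m → ℝ => (∑ j, w j * v j) * (∑ j, w j * u j))
    (by fun_prop)
  rw [← h, rowLaw, hfst.map_eq, integral_sum_mul_sum_gaussian]

/-- Deleting a row when its preactivation is not positive halves its second moments. -/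
theorem integral_relu_row (hCb : 0 < Cb) (h v u : EuclideanSpace ℝ (Fin m)) :
    Integrable (fun r : (Fin m → ℝ) × ℝ => (if 0 < (∑ j, r.1 j * h j) + r.2 then
        ∑ j, r.1 j * v j else 0) * (if 0 < (∑ j, r.1 j * h j) + r.2 then ∑ j, r.1 j * u j else 0))
      (rowLaw m s Cb) ∧
    ∫ r : (Fin m → ℝ) × ℝ, (if 0 < (∑ j, r.1 j * h j) + r.2 then ∑ j, r.1 j * v j else 0) *
        (if 0 < (∑ j, r.1 j * h j) + r.2 then ∑ j, r.1 j * u j else 0) ∂rowLaw m s Cb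
      = s / 2 * inner ℝ v u := by
  have hprod : ∀ r : (Fin m → ℝ) × ℝ,
      (if 0 < (∑ j, r.1 j * h j) + r.2 then ∑ j, r.1 j * v j else 0) *
        (if 0 < (∑ j, r.1 j * h j) + r.2 then ∑ j, r.1 j * u j else 0) =
      if 0 < (∑ j, r.1 j * h j) + r.2 then (∑ j, r.1 j * v j) * (∑ j, r.1 j * u j) else 0 := by
    intro r; split_ifs <;> simp
  have hl : Measurable fun r : (Fin m → ℝ) × ℝ => (∑ j, r.1 j * h j) + r.2 := by fun_prop
  simp_rw [hprod]
  refine ⟨(integrable_sum_mul_sum_rowLaw s Cb v u).indicator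
    (measurableSet_lt measurable_const hl), ?_⟩
  rw [integral_ite_pos_of_even (measurePreserving_neg_rowLaw m s Cb)
    (integrable_sum_mul_sum_rowLaw s Cb v u) (fun r => by simp) hl (fun r => by simp; ring)
    (ae_rowLaw_ne_zero hCb h), integral_sum_mul_sum_rowLaw]
  ring

end RandomGram

/-! ### The network, its derivative and its law -/

section Network

/-- The derivative of `relu` at a point `v` all of whose coordinates are nonzero: the coordinate
projection onto the positive coordinates of `v`. -/
noncomputable def reluMask {k : ℕ} (v : EuclideanSpace ℝ (Fin k)) :
    EuclideanSpace ℝ (Fin k) →L[ℝ] EuclideanSpace ℝ (Fin k) :=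
  LinearMap.toContinuousLinearMap
    { toFun := fun w => WithLp.toLp 2 fun i => if 0 < v i then w i else 0
      map_add' := fun w w' => by ext i; by_cases h : 0 < v i <;> simp [h]
      map_smul' := fun c w => by ext i; by_cases h : 0 < v i <;> simp [h] }

theorem reluMask_apply {k : ℕ} (v w : EuclideanSpace ℝ (Fin k)) :
    reluMask v w = WithLp.toLp 2 fun i => if 0 < v i then w i else 0 := rfl

theorem hasFDerivAt_relu {k : ℕ} {v : EuclideanSpace ℝ (Fin k)} (hv : ∀ i, v i ≠ 0) :
    HasFDerivAt relu (reluMask v) v := by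
  refine (reluMask v).hasFDerivAt.congr_of_eventuallyEq ?_
  have h : ∀ i, ∀ᶠ w : EuclideanSpace ℝ (Fin k) in nhds v,
      max (w i) 0 = if 0 < v i then w i else 0 := by
    intro i
    have hc : Filter.Tendsto (fun w : EuclideanSpace ℝ (Fin k) => w i) (nhds v) (nhds (v i)) :=
      Continuous.tendsto (by fun_prop) v
    rcases lt_or_gt_of_ne (hv i) with hi | hi
    · filter_upwards [hc.eventually_lt_const hi] with w hw
      rw [if_neg hi.not_gt, max_eq_right hw.le]
    · filter_upwards [hc.eventually_const_lt hi] with w hw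
      rw [if_pos hi, max_eq_left hw.le]
  filter_upwards [Filter.eventually_all.2 h] with w hw
  ext i
  exact hw i

theorem lipschitzWith_relu {k : ℕ} :
    LipschitzWith 1 (relu : EuclideanSpace ℝ (Fin k) → EuclideanSpace ℝ (Fin k)) := by
  refine LipschitzWith.of_dist_le_mul fun v w => ?_
  rw [NNReal.coe_one, one_mul, EuclideanSpace.dist_eq, EuclideanSpace.dist_eq]
  refine Real.sqrt_le_sqrt (Finset.sum_le_sum fun i _ => ?_)
  have : dist (relu v i) (relu w i) ≤ dist (v i) (w i) := by
    simp only [relu, Real.dist_eq]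
    exact abs_max_sub_max_le_abs _ _ _
  gcongr

theorem continuous_relu {k : ℕ} :
    Continuous (relu : EuclideanSpace ℝ (Fin k) → EuclideanSpace ℝ (Fin k)) :=
  lipschitzWith_relu.continuous

variable {n : ℕ → ℕ}

/-- The linear part `h ↦ W h` of `affineLayer`. -/
noncomputable def linearLayer {ℓ : ℕ} (p : LayerParams n ℓ) :
    EuclideanSpace ℝ (Fin (n ℓ)) →L[ℝ] EuclideanSpace ℝ (Fin (n (ℓ + 1))) :=
  LinearMap.toContinuousLinearMap
    { toFun := fun h => WithLp.toLp 2 fun i => ∑ j, p.1 i j * h j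
      map_add' := fun h h' => by ext i; simp [mul_add, Finset.sum_add_distrib]
      map_smul' := fun c h => by ext i; simp [Finset.mul_sum, mul_left_comm] }

theorem linearLayer_apply {ℓ : ℕ} (p : LayerParams n ℓ) (h : EuclideanSpace ℝ (Fin (n ℓ))) :
    linearLayer p h = WithLp.toLp 2 fun i => ∑ j, p.1 i j * h j := rfl

theorem affineLayer_eq {ℓ : ℕ} (p : LayerParams n ℓ) :
    affineLayer p = fun h => linearLayer p h + WithLp.toLp 2 p.2 := rfl

theorem hasFDerivAt_affineLayer {ℓ : ℕ} (p : LayerParams n ℓ) (h : EuclideanSpace ℝ (Fin (n ℓ))) :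
    HasFDerivAt (affineLayer p) (linearLayer p) h := by
  rw [affineLayer_eq]
  exact (linearLayer p).hasFDerivAt.add_const _

theorem lipschitzWith_affineLayer {ℓ : ℕ} (p : LayerParams n ℓ) :
    LipschitzWith ‖linearLayer p‖₊ (affineLayer p) := by
  refine LipschitzWith.of_dist_le_mul fun v w => ?_
  rw [affineLayer_eq]
  simp only [dist_add_right]
  exact (linearLayer p).lipschitz.dist_le_mul v w

theorem continuous_affineLayer {ℓ : ℕ} :
    Continuous fun q : LayerParams n ℓ × EuclideanSpace ℝ (Fin (n ℓ)) => affineLayer q.1 q.2 := by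
  unfold affineLayer
  fun_prop

variable {L : ℕ}

/-- The formal derivative of the activations in layer `k`, by the chain rule, with `reluMask` as the
derivative of `relu`. -/
noncomputable def activationsDeriv (θ : NetParams n L) :
    (k : ℕ) → k ≤ L → EuclideanSpace ℝ (Fin (n 0)) →
      EuclideanSpace ℝ (Fin (n 0)) →L[ℝ] EuclideanSpace ℝ (Fin (n k))
  | 0, _, _ => ContinuousLinearMap.id ℝ _
  | k + 1, hk, x =>
      (reluMask (affineLayer (n := n) (ℓ := k) (θ ⟨k, hk⟩)
          (activations θ k (Nat.le_of_succ_le hk) x))).comp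
        ((linearLayer (n := n) (ℓ := k) (θ ⟨k, hk⟩)).comp
          (activationsDeriv θ k (Nat.le_of_succ_le hk) x))

/-- All preactivations of the layers `1, …, k` are nonzero at the input `x`, so that the activations
in layer `k` are affine near `x`. -/
def IsRegularInput (θ : NetParams n L) (k : ℕ) (hk : k ≤ L) (x : EuclideanSpace ℝ (Fin (n 0))) :
    Prop :=
  ∀ (j : ℕ) (hj : j < k) (i : Fin (n (j + 1))),
    affineLayer (n := n) (ℓ := j) (θ ⟨j, hj.trans_le hk⟩)
      (activations θ j (hj.le.trans hk) x) i ≠ 0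

theorem IsRegularInput.hasFDerivAt_activations {θ : NetParams n L} {k : ℕ} {hk : k ≤ L}
    {x : EuclideanSpace ℝ (Fin (n 0))} (h : IsRegularInput θ k hk x) :
    HasFDerivAt (activations θ k hk) (activationsDeriv θ k hk x) x := by
  induction k with
  | zero => exact hasFDerivAt_id x
  | succ k ih =>
    have h1 := ih (hk := Nat.le_of_succ_le hk) fun j hj i => h j (hj.trans k.lt_succ_self) i
    exact (hasFDerivAt_relu (h k k.lt_succ_self)).comp x
      ((hasFDerivAt_affineLayer _ _).comp x h1)

theorem exists_lipschitzWith_activations (θ : NetParams n L) (k : ℕ) (hk : k ≤ L) :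
    ∃ K, LipschitzWith K (activations θ k hk) := by
  induction k with
  | zero => exact ⟨1, LipschitzWith.id⟩
  | succ k ih =>
    obtain ⟨K, hK⟩ := ih (Nat.le_of_succ_le hk)
    exact ⟨_, lipschitzWith_relu.comp ((lipschitzWith_affineLayer _).comp hK)⟩

theorem continuous_activations (k : ℕ) (hk : k ≤ L) :
    Continuous fun q : NetParams n L × EuclideanSpace ℝ (Fin (n 0)) =>
      activations q.1 k hk q.2 := by
  induction k with
  | zero => exact continuous_snd
  | succ k ih =>
    refine continuous_relu.comp (continuous_affineLayer.comp (f := fun q : NetParams n L × _ =>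
      (q.1 ⟨k, hk⟩, activations q.1 k (Nat.le_of_succ_le hk) q.2)) ?_)
    exact ((continuous_apply _).comp continuous_fst).prodMk (ih _)

theorem continuous_affineLayer_activations (k : ℕ) (hk : k + 1 ≤ L) :
    Continuous fun q : NetParams n L × EuclideanSpace ℝ (Fin (n 0)) =>
      affineLayer (n := n) (ℓ := k) (q.1 ⟨k, hk⟩)
        (activations q.1 k (Nat.le_of_succ_le hk) q.2) := by
  refine continuous_affineLayer.comp (f := fun q : NetParams n L × _ =>
    (q.1 ⟨k, hk⟩, activations q.1 k (Nat.le_of_succ_le hk) q.2)) ?_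
  exact ((continuous_apply _).comp continuous_fst).prodMk (continuous_activations k _)

theorem measurable_linearLayer {ℓ : ℕ} : Measurable
    fun q : LayerParams n ℓ × EuclideanSpace ℝ (Fin (n ℓ)) => linearLayer q.1 q.2 := by
  simp_rw [linearLayer_apply]
  refine Continuous.measurable ?_
  fun_prop

theorem measurable_reluMask {k : ℕ} : Measurable
    fun q : EuclideanSpace ℝ (Fin k) × EuclideanSpace ℝ (Fin k) => reluMask q.1 q.2 := by
  simp_rw [reluMask_apply]
  refine (WithLp.measurable_toLp 2 _).comp (measurable_pi_lambda _ fun i => ?_)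
  refine Measurable.ite (measurableSet_lt measurable_const ?_) ?_ measurable_const
  · exact Continuous.measurable (by fun_prop)
  · exact Continuous.measurable (by fun_prop)

theorem measurable_activationsDeriv (k : ℕ) (hk : k ≤ L) :
    Measurable fun q : NetParams n L × EuclideanSpace ℝ (Fin (n 0)) ×
        EuclideanSpace ℝ (Fin (n 0)) => activationsDeriv q.1 k hk q.2.1 q.2.2 := by
  induction k with
  | zero => exact measurable_snd.comp measurable_snd
  | succ k ih =>
    have hact : Measurable fun q : NetParams n L × EuclideanSpace ℝ (Fin (n 0)) ×
        EuclideanSpace ℝ (Fin (n 0)) => activations q.1 k (Nat.le_of_succ_le hk) q.2.1 :=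
      (continuous_activations k _).measurable.comp
        (measurable_fst.prodMk (measurable_fst.comp measurable_snd))
    have hθ : Measurable fun q : NetParams n L × EuclideanSpace ℝ (Fin (n 0)) ×
        EuclideanSpace ℝ (Fin (n 0)) => q.1 ⟨k, hk⟩ :=
      (measurable_pi_apply _).comp measurable_fst
    exact measurable_reluMask.comp ((continuous_affineLayer.measurable.comp
      (hθ.prodMk hact)).prodMk (measurable_linearLayer.comp (hθ.prodMk (ih _))))

theorem measurableSet_isRegularInput (k : ℕ) (hk : k ≤ L) :
    MeasurableSet {q : NetParams n L × EuclideanSpace ℝ (Fin (n 0)) |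
      IsRegularInput q.1 k hk q.2} := by
  simp only [IsRegularInput, Set.ofPred_forall]
  refine .iInter fun j => .iInter fun hj => .iInter fun i => ?_
  refine (MeasurableSet.preimage (measurableSet_singleton (0 : ℝ)) ?_).compl
  have h : Continuous fun q : NetParams n L × EuclideanSpace ℝ (Fin (n 0)) =>
      affineLayer (n := n) (ℓ := j) (q.1 ⟨j, hj.trans_le hk⟩)
        (activations q.1 j (hj.le.trans hk) q.2) :=
    continuous_affineLayer_activations j (hj.trans_le hk)
  have h' : Continuous fun v : EuclideanSpace ℝ (Fin (n (j + 1))) => v i := by fun_prop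
  exact (h'.comp h).measurable

theorem activations_update (θ : NetParams n L) {j : ℕ} (hj : j < L) (p : LayerParams n j) (k : ℕ)
    (hk : k ≤ L) (hkj : k ≤ j) :
    activations (Function.update θ ⟨j, hj⟩ p) k hk = activations θ k hk := by
  induction k with
  | zero => rfl
  | succ k ih =>
    have hne : (⟨k, hk⟩ : Fin L) ≠ ⟨j, hj⟩ := fun h => by
      have := Fin.mk.inj h; omega
    ext1 x
    simp only [activations, ih (Nat.le_of_succ_le hk) (Nat.le_of_succ_le hkj),
      Function.update_of_ne hne]

theorem activationsDeriv_update (θ : NetParams n L) {j : ℕ} (hj : j < L) (p : LayerParams n j)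
    (k : ℕ) (hk : k ≤ L) (hkj : k ≤ j) :
    activationsDeriv (Function.update θ ⟨j, hj⟩ p) k hk = activationsDeriv θ k hk := by
  induction k with
  | zero => rfl
  | succ k ih =>
    have hne : (⟨k, hk⟩ : Fin L) ≠ ⟨j, hj⟩ := fun h => by
      have := Fin.mk.inj h; omega
    ext1 x
    simp only [activationsDeriv, ih (Nat.le_of_succ_le hk) (Nat.le_of_succ_le hkj),
      Function.update_of_ne hne,
      activations_update θ hj p k (Nat.le_of_succ_le hk) (Nat.le_of_succ_le hkj)]

/-! ### Expectations over the random parameters -/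

/-- The law of the weights (of variance `s`) and biases of one layer. -/
noncomputable def layerLaw (n : ℕ → ℕ) (ℓ : ℕ) (s Cb : ℝ≥0) : Measure (LayerParams n ℓ) :=
  (Measure.pi fun _ => Measure.pi fun _ => gaussianReal 0 s).prod
    (Measure.pi fun _ => gaussianReal 0 Cb)

instance (ℓ : ℕ) (s Cb : ℝ≥0) : IsProbabilityMeasure (layerLaw n ℓ s Cb) := by
  unfold layerLaw; infer_instance

theorem paramLaw_eq (c : ℕ → ℝ≥0) (Cb : ℝ≥0) :
    paramLaw n L c Cb = Measure.pi fun ℓ : Fin L => layerLaw n ℓ (c ℓ / (n ℓ : ℝ≥0)) Cb := rfl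

instance (c : ℕ → ℝ≥0) (Cb : ℝ≥0) : IsProbabilityMeasure (paramLaw n L c Cb) := by
  rw [paramLaw_eq]; infer_instance

theorem measurePreserving_layerLaw (ℓ : ℕ) (s Cb : ℝ≥0) :
    MeasurePreserving (MeasurableEquiv.arrowProdEquivProdArrow (Fin (n ℓ) → ℝ) ℝ (Fin (n (ℓ + 1))))
      (Measure.pi fun _ => rowLaw (n ℓ) s Cb) (layerLaw n ℓ s Cb) :=
  measurePreserving_arrowProdEquivProdArrow _ _ _ _ _

theorem ae_affineLayer_ne_zero {ℓ : ℕ} {s Cb : ℝ≥0} (hCb : 0 < Cb)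
    (h : EuclideanSpace ℝ (Fin (n ℓ))) (i : Fin (n (ℓ + 1))) :
    ∀ᵐ p ∂layerLaw n ℓ s Cb, affineLayer p h i ≠ 0 := by
  have hmp : MeasurePreserving (fun p : LayerParams n ℓ => (p.1 i, p.2 i)) (layerLaw n ℓ s Cb)
      (rowLaw (n ℓ) s Cb) :=
    (measurePreserving_eval (fun _ => Measure.pi fun _ => gaussianReal 0 s) i).prod
      (measurePreserving_eval (fun _ => gaussianReal 0 Cb) i)
  have h0 := ae_rowLaw_ne_zero (s := s) hCb h
  rw [← hmp.map_eq] at h0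
  exact ae_of_ae_map hmp.measurable.aemeasurable h0

variable {d : ℕ}

theorem lintegral_det_gram_linearLayer {ℓ : ℕ} (s Cb : ℝ≥0)
    (v : Fin d → EuclideanSpace ℝ (Fin (n ℓ))) :
    ∫⁻ p, ENNReal.ofReal (Matrix.gram ℝ fun a => linearLayer p (v a)).det ∂layerLaw n ℓ s Cb
      = ENNReal.ofReal ((n (ℓ + 1)).descFactorial d * (s : ℝ) ^ d)
        * ENNReal.ofReal (Matrix.gram ℝ v).det := by
  rw [← (measurePreserving_layerLaw ℓ s Cb).lintegral_comp_emb
    (MeasurableEquiv.measurableEmbedding _), ← ENNReal.ofReal_mul (by positivity), mul_assoc]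
  have hS : (s : ℝ) ^ d * (Matrix.gram ℝ v).det = ((s : ℝ) • Matrix.gram ℝ v).det := by
    rw [Matrix.det_smul, Fintype.card_fin]
  rw [hS]
  exact lintegral_det_gram_of_iid_rows (n (ℓ + 1)) (rowLaw (n ℓ) s Cb)
    (fun r a => ∑ j, r.1 j * v a j) _
    (fun a b => integrable_sum_mul_sum_rowLaw s Cb _ _)
    (fun a b => integral_sum_mul_sum_rowLaw s Cb _ _)

theorem lintegral_det_gram_reluMask {ℓ : ℕ} (s : ℝ≥0) {Cb : ℝ≥0} (hCb : 0 < Cb)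
    (h : EuclideanSpace ℝ (Fin (n ℓ))) (v : Fin d → EuclideanSpace ℝ (Fin (n ℓ))) :
    ∫⁻ p, ENNReal.ofReal
        (Matrix.gram ℝ fun a => reluMask (affineLayer p h) (linearLayer p (v a))).det
        ∂layerLaw n ℓ s Cb
      = ENNReal.ofReal ((n (ℓ + 1)).descFactorial d * (s / 2 : ℝ) ^ d)
        * ENNReal.ofReal (Matrix.gram ℝ v).det := by
  rw [← (measurePreserving_layerLaw ℓ s Cb).lintegral_comp_emb
    (MeasurableEquiv.measurableEmbedding _), ← ENNReal.ofReal_mul (by positivity), mul_assoc]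
  have hS : (s / 2 : ℝ) ^ d * (Matrix.gram ℝ v).det = ((s / 2 : ℝ) • Matrix.gram ℝ v).det := by
    rw [Matrix.det_smul, Fintype.card_fin]
  rw [hS]
  exact lintegral_det_gram_of_iid_rows (n (ℓ + 1)) (rowLaw (n ℓ) s Cb)
    (fun r a => if 0 < (∑ j, r.1 j * h j) + r.2 then ∑ j, r.1 j * v a j else 0) _
    (fun a b => (integral_relu_row s Cb hCb h _ _).1)
    (fun a b => (integral_relu_row s Cb hCb h _ _).2)

/-- Tonelli's theorem for the parameters: the parameters of layer `j` can be integrated first, with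
those of the other layers frozen. -/
theorem lintegral_paramLaw_update (c : ℕ → ℝ≥0) (Cb : ℝ≥0) {j : ℕ} (hj : j < L)
    {f : NetParams n L → ℝ≥0∞} (hf : Measurable f) :
    ∫⁻ θ, f θ ∂paramLaw n L c Cb =
      ∫⁻ θ, ∫⁻ p, f (Function.update θ ⟨j, hj⟩ p) ∂layerLaw n j (c j / (n j : ℝ≥0)) Cb
        ∂paramLaw n L c Cb := by
  have hup : Measurable fun q : NetParams n L × LayerParams n j =>
      Function.update q.1 (⟨j, hj⟩ : Fin L) q.2 := by
    refine measurable_pi_lambda _ fun i => ?_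
    by_cases hi : i = ⟨j, hj⟩
    · subst hi
      simpa using measurable_snd
    · simp only [Function.update_of_ne hi]
      exact (measurable_pi_apply i).comp measurable_fst
  have hg : Measurable fun θ : NetParams n L =>
      ∫⁻ p, f (Function.update θ ⟨j, hj⟩ p) ∂layerLaw n j (c j / (n j : ℝ≥0)) Cb :=
    (hf.comp hup).lintegral_prod_right'
  rw [paramLaw_eq]
  refine lintegral_eq_of_lmarginal_eq {⟨j, hj⟩} hf hg ?_
  ext θ
  rw [lmarginal_singleton, lmarginal_singleton]
  simp

/-- The mean squared Jacobian of the activations on a frame `v` at `x` depends on neither the point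
`x` nor, apart from the factor `det (gram v)`, the frame. -/
theorem lintegral_det_gram_activationsDeriv (c : ℕ → ℝ≥0) {Cb : ℝ≥0} (hCb : 0 < Cb) (k : ℕ)
    (hk : k ≤ L) (x : EuclideanSpace ℝ (Fin (n 0))) (v : Fin d → EuclideanSpace ℝ (Fin (n 0))) :
    ∫⁻ θ, ENNReal.ofReal (Matrix.gram ℝ fun a => activationsDeriv θ k hk x (v a)).det
        ∂paramLaw n L c Cb
      = ENNReal.ofReal (∏ j ∈ Finset.range k,
          ((n (j + 1)).descFactorial d * (((c j / n j : ℝ≥0) : ℝ) / 2) ^ d))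
        * ENNReal.ofReal (Matrix.gram ℝ v).det := by
  induction k with
  | zero => simp [activationsDeriv]
  | succ k ih =>
    have hmeas : ∀ (k : ℕ) (hk : k ≤ L), Measurable fun θ : NetParams n L =>
        ENNReal.ofReal (Matrix.gram ℝ fun a => activationsDeriv θ k hk x (v a)).det := by
      intro k hk
      refine (continuous_det_gram.measurable.comp
        (measurable_pi_lambda _ fun a => ?_)).ennreal_ofReal
      exact (measurable_activationsDeriv k hk).comp
        (measurable_id.prodMk (measurable_const.prodMk measurable_const))
    rw [lintegral_paramLaw_update c Cb hk (hmeas _ _)]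
    have hstep : ∀ θ : NetParams n L, ∫⁻ p, ENNReal.ofReal (Matrix.gram ℝ fun a =>
          activationsDeriv (Function.update θ ⟨k, hk⟩ p) (k + 1) hk x (v a)).det
          ∂layerLaw n k (c k / (n k : ℝ≥0)) Cb
        = ENNReal.ofReal ((n (k + 1)).descFactorial d * (((c k / n k : ℝ≥0) : ℝ) / 2) ^ d) *
          ENNReal.ofReal (Matrix.gram ℝ fun a =>
            activationsDeriv θ k (Nat.le_of_succ_le hk) x (v a)).det := by
      intro θ
      rw [← lintegral_det_gram_reluMask (c k / (n k : ℝ≥0)) hCb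
        (activations θ k (Nat.le_of_succ_le hk) x)]
      refine lintegral_congr fun p => ?_
      simp only [activationsDeriv, activations_update θ hk p k (Nat.le_of_succ_le hk) le_rfl,
        activationsDeriv_update θ hk p k (Nat.le_of_succ_le hk) le_rfl, Function.update_self]
      rfl
    simp_rw [hstep]
    rw [lintegral_const_mul _ (hmeas _ _), ih, ← mul_assoc, Finset.prod_range_succ,
      ← ENNReal.ofReal_mul (by positivity), mul_comm (∏ j ∈ Finset.range k, _)]

theorem lintegral_det_gram_linearLayer_activationsDeriv (c : ℕ → ℝ≥0) {Cb : ℝ≥0} (hCb : 0 < Cb)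
    (k : ℕ) (hk : k + 1 ≤ L) (x : EuclideanSpace ℝ (Fin (n 0)))
    (v : Fin d → EuclideanSpace ℝ (Fin (n 0))) :
    ∫⁻ θ, ENNReal.ofReal (Matrix.gram ℝ fun a => linearLayer (n := n) (ℓ := k) (θ ⟨k, hk⟩)
        (activationsDeriv θ k (Nat.le_of_succ_le hk) x (v a))).det ∂paramLaw n L c Cb
      = ENNReal.ofReal ((n (k + 1)).descFactorial d * ((c k / n k : ℝ≥0) : ℝ) ^ d *
          ∏ j ∈ Finset.range k,
            ((n (j + 1)).descFactorial d * (((c j / n j : ℝ≥0) : ℝ) / 2) ^ d))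
        * ENNReal.ofReal (Matrix.gram ℝ v).det := by
  have hD : ∀ a, Measurable fun θ : NetParams n L =>
      activationsDeriv θ k (Nat.le_of_succ_le hk) x (v a) := fun a =>
    (measurable_activationsDeriv k _).comp
      (measurable_id.prodMk (measurable_const.prodMk measurable_const))
  rw [lintegral_paramLaw_update c Cb hk]
  · simp_rw [activationsDeriv_update _ hk _ k (Nat.le_of_succ_le hk) le_rfl, Function.update_self,
      lintegral_det_gram_linearLayer]
    rw [lintegral_const_mul, lintegral_det_gram_activationsDeriv c hCb, ← mul_assoc,
      ← ENNReal.ofReal_mul (by positivity)]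
    exact (continuous_det_gram.measurable.comp (measurable_pi_lambda _ hD)).ennreal_ofReal
  · refine (continuous_det_gram.measurable.comp
      (measurable_pi_lambda _ fun a => ?_)).ennreal_ofReal
    have hθ : Measurable fun θ : NetParams n L => θ ⟨k, hk⟩ := measurable_pi_apply _
    exact measurable_linearLayer.comp (hθ.prodMk (hD a))

theorem ae_isRegularInput (c : ℕ → ℝ≥0) {Cb : ℝ≥0} (hCb : 0 < Cb) (k : ℕ) (hk : k ≤ L)
    (x : EuclideanSpace ℝ (Fin (n 0))) :
    ∀ᵐ θ ∂paramLaw n L c Cb, IsRegularInput θ k hk x := by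
  simp only [IsRegularInput]
  rw [ae_all_iff]
  intro j
  rw [ae_all_iff]
  intro hj
  rw [ae_all_iff]
  intro i
  have hcont : Continuous fun θ : NetParams n L => affineLayer (n := n) (ℓ := j)
      (θ ⟨j, hj.trans_le hk⟩) (activations θ j (hj.le.trans hk) x) i := by
    have h : Continuous fun θ : NetParams n L => affineLayer (n := n) (ℓ := j)
        (θ ⟨j, hj.trans_le hk⟩) (activations θ j (hj.le.trans hk) x) :=
      (continuous_affineLayer_activations j (hj.trans_le hk)).comp
        (continuous_id.prodMk continuous_const)
    have h' : Continuous fun v : EuclideanSpace ℝ (Fin (n (j + 1))) => v i := by fun_prop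
    exact h'.comp h
  set A : Set (NetParams n L) := {θ | affineLayer (n := n) (ℓ := j) (θ ⟨j, hj.trans_le hk⟩)
    (activations θ j (hj.le.trans hk) x) i = 0} with hA
  have hAm : MeasurableSet A := (measurableSet_singleton (0 : ℝ)).preimage hcont.measurable
  have hA0 : paramLaw n L c Cb A = 0 := by
    rw [← lintegral_indicator_one hAm, lintegral_paramLaw_update c Cb (hj.trans_le hk)
      (measurable_one.indicator hAm)]
    refine (lintegral_congr fun θ => ?_).trans lintegral_zero
    rw [lintegral_eq_zero_iff']
    · filter_upwards [ae_affineLayer_ne_zero hCb (activations θ j (hj.le.trans hk) x) i] with p hp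
      have : Function.update θ ⟨j, hj.trans_le hk⟩ p ∉ A := by
        simp only [hA, Set.mem_ofPred_eq, Function.update_self]
        rw [activations_update θ _ p j _ le_rfl]
        exact hp
      simp [this]
    · exact (Measurable.comp (measurable_one.indicator hAm)
        (measurable_update θ (a := ⟨j, hj.trans_le hk⟩))).aemeasurable
  rw [ae_iff]
  simpa using hA0

end Network

/-! ### Second moments of volumes -/

section SecondMoment

variable {Θ P : Type*} [MeasurableSpace Θ] [MeasurableSpace P]

/-- Minkowski's integral inequality for `L²` norms, given a pointwise bound on these. -/
theorem lintegral_sq_lintegral_le (μ : Measure Θ) [SFinite μ] (m : Measure P) [SFinite m]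
    {G : Θ → P → ℝ≥0∞} (hG : Measurable (Function.uncurry G)) {g : P → ℝ≥0∞} (hg : Measurable g)
    {C : ℝ≥0∞} (hC : ∀ p, ∫⁻ θ, G θ p ^ 2 ∂μ ≤ C * g p ^ 2) :
    ∫⁻ θ, (∫⁻ p, G θ p ∂m) ^ 2 ∂μ ≤ C * (∫⁻ p, g p ∂m) ^ 2 := by
  have hGp : ∀ p, Measurable fun θ => G θ p := fun p => hG.of_uncurry_right
  have hGθ : ∀ θ, Measurable (G θ) := fun θ => hG.of_uncurry_left
  have hGG : Measurable fun q : Θ × P × P => G q.1 q.2.1 * G q.1 q.2.2 :=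
    (hG.comp (measurable_fst.prodMk (measurable_fst.comp measurable_snd))).mul
      (hG.comp (measurable_fst.prodMk (measurable_snd.comp measurable_snd)))
  -- Cauchy–Schwarz in `θ`, for two fixed points `p` and `q`
  have hCS : ∀ p q, ∫⁻ θ, G θ p * G θ q ∂μ ≤ C * (g p * g q) := by
    intro p q
    have hroot : ∀ p, (C * g p ^ 2) ^ (1 / 2 : ℝ) = C ^ (1 / 2 : ℝ) * g p := by
      intro p
      rw [ENNReal.mul_rpow_of_nonneg _ _ (by norm_num), ← ENNReal.rpow_natCast, ← ENNReal.rpow_mul]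
      norm_num
    have hCC : C ^ (1 / 2 : ℝ) * C ^ (1 / 2 : ℝ) = C := by
      rw [← ENNReal.rpow_add_of_nonneg _ _ (by norm_num) (by norm_num)]
      norm_num
    have h := ENNReal.lintegral_mul_le_Lp_mul_Lq μ (p := 2) (q := 2) (.two_two)
      (hGp p).aemeasurable (hGp q).aemeasurable
    calc ∫⁻ θ, G θ p * G θ q ∂μ
        ≤ (C * g p ^ 2) ^ (1 / 2 : ℝ) * (C * g q ^ 2) ^ (1 / 2 : ℝ) := by
          refine h.trans ?_
          simp only [ENNReal.rpow_ofNat]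
          gcongr
          · exact hC p
          · exact hC q
      _ = (C ^ (1 / 2 : ℝ) * C ^ (1 / 2 : ℝ)) * (g p * g q) := by rw [hroot, hroot]; ring
      _ = _ := by rw [hCC]
  calc ∫⁻ θ, (∫⁻ p, G θ p ∂m) ^ 2 ∂μ
      = ∫⁻ θ, ∫⁻ z, G θ z.1 * G θ z.2 ∂(m.prod m) ∂μ := by
        refine lintegral_congr fun θ => ?_
        rw [lintegral_prod_mul (hGθ θ).aemeasurable (hGθ θ).aemeasurable, pow_two]
    _ = ∫⁻ z, ∫⁻ θ, G θ z.1 * G θ z.2 ∂μ ∂(m.prod m) := lintegral_lintegral_swap hGG.aemeasurable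
    _ ≤ ∫⁻ z, C * (g z.1 * g z.2) ∂(m.prod m) := lintegral_mono fun z => hCS z.1 z.2
    _ = C * (∫⁻ p, g p ∂m) ^ 2 := by
        rw [lintegral_const_mul _ (by fun_prop),
          lintegral_prod_mul hg.aemeasurable hg.aemeasurable, pow_two]

theorem sqMeanAndVarianceLE_of_lintegral_sq_le {μ : Measure Θ} [IsProbabilityMeasure μ]
    {V : Θ → ℝ≥0∞} (hV : Measurable V) {B : ℝ} (hB : 0 ≤ B)
    (h : ∫⁻ θ, V θ ^ 2 ∂μ ≤ ENNReal.ofReal B) : SqMeanAndVarianceLE μ V B := by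
  have hfin : ∫⁻ θ, V θ ^ 2 ∂μ ≠ ⊤ := (h.trans_lt ENNReal.ofReal_lt_top).ne
  have hsq : ∀ θ, (V θ).toReal ^ 2 = (V θ ^ 2).toReal := fun θ => (ENNReal.toReal_pow _ _).symm
  have hm : AEStronglyMeasurable (fun θ => (V θ).toReal) μ :=
    hV.ennreal_toReal.aestronglyMeasurable
  have hL2 : MemLp (fun θ => (V θ).toReal) 2 μ := by
    rw [memLp_two_iff_integrable_sq hm]
    simp_rw [hsq]
    exact integrable_toReal_of_lintegral_ne_top (hV.pow_const 2).aemeasurable hfin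
  have hae : ∀ᵐ θ ∂μ, V θ ^ 2 < ⊤ := ae_lt_top (hV.pow_const 2) hfin
  have hint : ∫ θ, (V θ).toReal ^ 2 ∂μ ≤ B := by
    simp_rw [hsq]
    rw [integral_toReal (hV.pow_const 2).aemeasurable hae]
    exact ENNReal.toReal_le_of_le_ofReal hB h
  have hvar := variance_eq_sub hL2
  have hpos := variance_nonneg (fun θ => (V θ).toReal) μ
  simp only [Pi.pow_apply] at hvar
  refine ⟨?_, hL2, by linarith, ?_⟩
  · filter_upwards [hae] with θ hθ h
    simp [h] at hθ
  · nlinarith [sq_nonneg (∫ θ, (V θ).toReal ∂μ)]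

/-- For a random Lipschitz map `N θ` with derivative `D θ x` at almost every parameter, a bound by
`C` on the mean squared Jacobian on every frame bounds the second moment of the volume of the image
of a submanifold of unit volume. -/
theorem sqMeanAndVarianceLE_volume_image {d : ℕ} (hd : 0 < d) {F : Type*} [NormedAddCommGroup F]
    [InnerProductSpace ℝ F] [FiniteDimensional ℝ F] [MeasurableSpace F] [BorelSpace F]
    {H : Type*} [TopologicalSpace H] (I : ModelWithCorners ℝ (EuclideanSpace ℝ (Fin d)) H)
    (M : Set F) [ChartedSpace H M] [IsManifold I ∞ M]
    (hM : ContMDiff I 𝓘(ℝ, F) ∞ (Subtype.val : M → F)) (hvol : μHE[d] M = 1)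
    {Θ : Type*} [TopologicalSpace Θ] [MeasurableSpace Θ] [OpensMeasurableSpace Θ] (μ : Measure Θ)
    [IsProbabilityMeasure μ] {k : ℕ} {N : Θ → F → EuclideanSpace ℝ (Fin k)}
    {D : Θ → F → F →L[ℝ] EuclideanSpace ℝ (Fin k)} {regular : Θ → F → Prop}
    (hN : Continuous (Function.uncurry N)) (hNlip : ∀ θ, ∃ K, LipschitzWith K (N θ))
    (hD : Measurable fun q : Θ × F × F => D q.1 q.2.1 q.2.2)
    (hreg : MeasurableSet {q : Θ × F | regular q.1 q.2})
    (hregD : ∀ θ x, regular θ x → HasFDerivAt (N θ) (D θ x) x)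
    (hreg_ae : ∀ x, ∀ᵐ θ ∂μ, regular θ x) {C B : ℝ} (hC : 0 ≤ C) (hCB : C ≤ B)
    (hDC : ∀ (x : F) (v : Fin d → F),
      ∫⁻ θ, ENNReal.ofReal (Matrix.gram ℝ fun a => D θ x (v a)).det ∂μ
        = ENNReal.ofReal C * ENNReal.ofReal (Matrix.gram ℝ v).det) :
    SqMeanAndVarianceLE μ (fun θ => μHE[d] (N θ '' M)) B := by
  have hne : Nonempty M := by
    by_contra h
    rw [not_nonempty_iff, Set.isEmpty_coe_sort] at h
    simp [h] at hvol
  obtain ⟨m, hm, hm1, hmN⟩ := exists_frameMeasure I M hM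
  have hsqrt : ∀ {t : ℝ}, 0 ≤ t → ENNReal.ofReal √t ^ 2 = ENNReal.ofReal t := fun ht => by
    rw [← ENNReal.ofReal_pow (Real.sqrt_nonneg _), Real.sq_sqrt ht]
  refine sqMeanAndVarianceLE_of_lintegral_sq_le
    (measurable_euclideanHausdorffMeasure_image hd hN (isSigmaCompact_of_chartedSpace I M))
    (hC.trans hCB) ?_
  -- for almost every parameter, almost every point of the manifold is regular
  have hae : ∀ᵐ θ ∂μ, ∀ᵐ p ∂m, regular θ p.1 := by
    rw [Measure.ae_ae_comm]
    · exact ae_of_all _ fun p => hreg_ae p.1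
    · exact hreg.preimage (measurable_fst.prodMk (measurable_fst.comp measurable_snd))
  have hG : Measurable (Function.uncurry fun (θ : Θ) (p : F × (Fin d → F)) =>
      ENNReal.ofReal √(Matrix.gram ℝ fun a => D θ p.1 (p.2 a)).det) := by
    refine (continuous_det_gram.measurable.comp
      (measurable_pi_lambda _ fun a => ?_)).sqrt.ennreal_ofReal
    exact hD.comp (measurable_fst.prodMk ((measurable_fst.comp measurable_snd).prodMk
      ((measurable_pi_apply a).comp (measurable_snd.comp measurable_snd))))
  calc ∫⁻ θ, μHE[d] (N θ '' M) ^ 2 ∂μ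
      ≤ ∫⁻ θ, (∫⁻ p, ENNReal.ofReal √(Matrix.gram ℝ fun a => D θ p.1 (p.2 a)).det ∂m) ^ 2 ∂μ := by
        refine lintegral_mono_ae ?_
        filter_upwards [hae] with θ hθ
        obtain ⟨K, hK⟩ := hNlip θ
        gcongr
        refine hmN k (N θ) (D θ) K hK ?_ ?_
        · exact hD.comp (measurable_const.prodMk measurable_id)
        · filter_upwards [hθ] with p hp using hregD θ p.1 hp
    _ ≤ ENNReal.ofReal C * (∫⁻ p, ENNReal.ofReal √(Matrix.gram ℝ p.2).det ∂m) ^ 2 := by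
        refine lintegral_sq_lintegral_le μ m hG
          (g := fun p => ENNReal.ofReal √(Matrix.gram ℝ p.2).det)
          (continuous_det_gram.measurable.comp measurable_snd).sqrt.ennreal_ofReal fun p => ?_
        simp_rw [hsqrt (det_gram_nonneg _)]
        exact (hDC p.1 p.2).le
    _ ≤ ENNReal.ofReal C * 1 ^ 2 := by
        gcongr
        exact hm1.trans hvol.le
    _ ≤ ENNReal.ofReal B := by
        rw [one_pow, mul_one]
        exact ENNReal.ofReal_le_ofReal hCB

end SecondMoment

section Bound

theorem descFactorial_le_pow_mul_exp {N : ℕ} (hN : 0 < N) {d : ℕ} (hd : d ≤ N) :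
    (N.descFactorial d : ℝ) ≤ (N : ℝ) ^ d * Real.exp (-((d.choose 2 : ℝ) * (N : ℝ)⁻¹)) := by
  have hN' : (0 : ℝ) < N := by exact_mod_cast hN
  induction d with
  | zero => simp
  | succ d ih =>
    have h1 : ((N - d : ℕ) : ℝ) ≤ N * Real.exp (-(d * (N : ℝ)⁻¹)) := by
      rw [Nat.cast_sub (Nat.le_of_succ_le hd)]
      have := Real.add_one_le_exp (-(d * (N : ℝ)⁻¹))
      calc (N : ℝ) - d = N * (-(d * (N : ℝ)⁻¹) + 1) := by field_simp; ring
        _ ≤ _ := by gcongr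
    have h2 : ((d + 1).choose 2 : ℝ) = d + d.choose 2 := by
      rw [Nat.choose_succ_succ' d 1, Nat.choose_one_right]
      push_cast
      ring
    rw [Nat.descFactorial_succ, Nat.cast_mul, h2, pow_succ]
    calc _ ≤ (N * Real.exp (-(d * (N : ℝ)⁻¹))) *
          ((N : ℝ) ^ d * Real.exp (-((d.choose 2 : ℝ) * (N : ℝ)⁻¹))) := by
          gcongr
          exact ih (Nat.le_of_succ_le hd)
      _ = (N : ℝ) ^ d * N *
          (Real.exp (-(d * (N : ℝ)⁻¹)) * Real.exp (-((d.choose 2 : ℝ) * (N : ℝ)⁻¹))) := by ring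
      _ = _ := by
          rw [← Real.exp_add]
          congr 2
          ring

theorem prod_descFactorial_le {n : ℕ → ℕ} {d : ℕ} (hd : 0 < d) (k : ℕ)
    (hdn : ∀ ℓ ≤ k, d ≤ n ℓ) :
    ∏ j ∈ Finset.range k, ((n (j + 1)).descFactorial d * ((n j : ℝ)⁻¹) ^ d) ≤
      ((n k : ℝ) / (n 0 : ℝ)) ^ d *
        Real.exp (-((d.choose 2 : ℝ) * ∑ ℓ ∈ Finset.Icc 1 k, ((n ℓ : ℝ))⁻¹)) := by
  induction k with
  | zero =>
    have : (n 0 : ℝ) ≠ 0 := by exact_mod_cast (hd.trans_le (hdn 0 le_rfl)).ne'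
    simp [this]
  | succ k ih =>
    have hk : (n k : ℝ) ≠ 0 := by
      exact_mod_cast (hd.trans_le (hdn k k.le_succ)).ne'
    rw [Finset.prod_range_succ, Finset.sum_Icc_succ_top (by omega)]
    calc _ ≤ (((n k : ℝ) / (n 0 : ℝ)) ^ d *
          Real.exp (-((d.choose 2 : ℝ) * ∑ ℓ ∈ Finset.Icc 1 k, ((n ℓ : ℝ))⁻¹))) *
          (((n (k + 1) : ℝ) ^ d * Real.exp (-((d.choose 2 : ℝ) * (n (k + 1) : ℝ)⁻¹))) *
            ((n k : ℝ)⁻¹) ^ d) := by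
          gcongr
          · exact ih fun ℓ hℓ => hdn ℓ (hℓ.trans k.le_succ)
          · exact descFactorial_le_pow_mul_exp (hd.trans_le (hdn _ le_rfl)) (hdn _ le_rfl)
      _ = (((n k : ℝ) / (n 0 : ℝ)) * n (k + 1) * (n k : ℝ)⁻¹) ^ d *
          (Real.exp (-((d.choose 2 : ℝ) * ∑ ℓ ∈ Finset.Icc 1 k, ((n ℓ : ℝ))⁻¹)) *
            Real.exp (-((d.choose 2 : ℝ) * (n (k + 1) : ℝ)⁻¹))) := by
          rw [mul_pow, mul_pow]; ring
      _ = _ := by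
          rw [← Real.exp_add]
          congr 2
          · field_simp
          · ring

end Bound

theorem theorem2
    (L : ℕ) (hL : 1 ≤ L) (n : ℕ → ℕ) (d : ℕ) (hd : 0 < d) (hdn : ∀ ℓ ≤ L, d ≤ n ℓ)
    (Cb : ℝ≥0) (hCb : 0 < Cb)
    -- `M` is an embedded smooth `d`-dimensional submanifold, possibly with boundary or corners,
    -- of unit `d`-dimensional volume
    {H : Type*} [TopologicalSpace H] (I : ModelWithCorners ℝ (EuclideanSpace ℝ (Fin d)) H)
    (M : Set (EuclideanSpace ℝ (Fin (n 0)))) [ChartedSpace H M] [IsManifold I ∞ M]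
    (hM : Manifold.IsSmoothEmbedding I 𝓘(ℝ, EuclideanSpace ℝ (Fin (n 0))) ∞
      (Subtype.val : M → EuclideanSpace ℝ (Fin (n 0))))
    (hvol : Measure.euclideanHausdorffMeasure d M = 1) :
    -- ReLU in every layer, all weights of variance `2 / fan-in`
    SqMeanAndVarianceLE (paramLaw n L (fun _ => 2) Cb)
      (fun θ => Measure.euclideanHausdorffMeasure d (reluOutputNetwork θ '' M))
      (((n L : ℝ) / (n 0 : ℝ)) ^ d *
        Real.exp (-((d.choose 2 : ℝ) * ∑ ℓ ∈ Finset.Icc 1 L, ((n ℓ : ℝ))⁻¹))) ∧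
    -- linear output layer with weights of variance `τ / fan-in`, other weights as before
    (∀ τ : ℝ≥0, 0 < τ →
      SqMeanAndVarianceLE (paramLaw n L (fun ℓ => if ℓ + 1 < L then 2 else τ) Cb)
        (fun θ => Measure.euclideanHausdorffMeasure d (linearOutputNetwork θ '' M))
        ((τ : ℝ) ^ d * (((n L : ℝ) / (n 0 : ℝ)) ^ d *
          Real.exp (-((d.choose 2 : ℝ) * ∑ ℓ ∈ Finset.Icc 1 L, ((n ℓ : ℝ))⁻¹))))) := by
  have hbound := prod_descFactorial_le hd L hdn
  have h2 : ∀ j, (((2 / n j : ℝ≥0) : ℝ) / 2) = (n j : ℝ)⁻¹ := fun j => by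
    push_cast
    ring
  constructor
  · refine sqMeanAndVarianceLE_volume_image hd I M hM.contMDiff hvol _
      (regular := fun θ x => IsRegularInput θ L le_rfl x) (continuous_activations L le_rfl)
      (fun θ => exists_lipschitzWith_activations θ L le_rfl) (measurable_activationsDeriv L le_rfl)
      (measurableSet_isRegularInput L le_rfl) (fun θ x h => h.hasFDerivAt_activations)
      (fun x => ae_isRegularInput _ hCb L le_rfl x) ?_ hbound fun x v => ?_
    · positivity
    · rw [lintegral_det_gram_activationsDeriv _ hCb L le_rfl x v]
      simp_rw [h2]
  · intro τ _
    obtain ⟨k, rfl⟩ : ∃ k, L = k + 1 := ⟨L - 1, by omega⟩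
    have hk : k ≤ k + 1 := k.le_succ
    refine sqMeanAndVarianceLE_volume_image hd I M hM.contMDiff hvol _
      (C := (τ : ℝ) ^ d * ∏ j ∈ Finset.range (k + 1),
        ((n (j + 1)).descFactorial d * ((n j : ℝ)⁻¹) ^ d))
      (D := fun θ x => (linearLayer (n := n) (ℓ := k) (θ ⟨k, k.lt_succ_self⟩)).comp
        (activationsDeriv θ k hk x))
      (regular := fun θ x => IsRegularInput θ k hk x)
      (continuous_affineLayer_activations k le_rfl)
      (fun θ => ?_) ?_
      (measurableSet_isRegularInput k hk) (fun θ x h => ?_)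
      (fun x => ae_isRegularInput _ hCb k hk x) (by positivity) (by gcongr) fun x v => ?_
    · obtain ⟨K, hK⟩ := exists_lipschitzWith_activations θ k hk
      exact ⟨_, (lipschitzWith_affineLayer _).comp hK⟩
    · have hθ : Measurable fun q : NetParams n (k + 1) × EuclideanSpace ℝ (Fin (n 0)) ×
          EuclideanSpace ℝ (Fin (n 0)) => q.1 ⟨k, k.lt_succ_self⟩ :=
        (measurable_pi_apply _).comp measurable_fst
      exact measurable_linearLayer.comp (hθ.prodMk (measurable_activationsDeriv k hk))
    · exact (hasFDerivAt_affineLayer _ _).comp x h.hasFDerivAt_activations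
    · refine (lintegral_det_gram_linearLayer_activationsDeriv _ hCb k le_rfl x v).trans ?_
      congr 2
      rw [if_neg (lt_irrefl _), Finset.prod_range_succ,
        Finset.prod_congr rfl fun j hj => by
          rw [if_pos (Nat.succ_lt_succ (Finset.mem_range.1 hj)), h2 j]]
      rw [NNReal.coe_div, NNReal.coe_natCast, div_eq_mul_inv, mul_pow]
      ring
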